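/- Let $0<\gamma\le 1$ and $L,\eta,b_0>0$. Let $F:\mathbb{R}^d\to\mathbb{R}$ be differentiable with a global minimizer $x^*$, and assume: 1. ($\gamma$-quasar convexity) $F(x^*)\ge F(x)+\frac1\gamma\langle\nabla F(x),x^*-x\rangle$ for all $x\in\mathbb{R}^d$; 2. ($L$-smoothness) $F(x)\le F(y)+\langle\nabla F(y),x-y\rangle+\frac L2\|x-y\|^2$ for all $x,y\in\mathbb{R}^d$. A stochastic gradient oracle queried at a point $x$ at step $t\ge1$ returns $\widehat\nabla_tF(x)=g(x,z_t)$, where $g$ is jointly measurable and $z_1,z_2,\dots$ are independent random variables (so the randomness of step $t$ is independent of the history). Assume that for some $\sigma\ge 0$, for all $x\in\mathbb{R}^d$ and $t\ge1$, 3. (unbiasedness) $\mathbb{E}[\widehat\nabla_tF(x)]=\nabla F(x)$; 4. (sub-Gaussian noise) $\mathbb{E}\big[\exp(\|\widehat\nabla_tF(x)-\nabla F(x)\|^2/\sigma^2)\big]\le \exp(1)$, which for $\sigma=0$ is read as $\widehat\nabla_tF(x)=\nabla F(x)$ almost surely. Stochastic AdaGradNorm starts from a deterministic point $x_1\in\mathbb{R}^d$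 and iterates, for $t\ge1$, $$b_t=\sqrt{b_0^2+\sum_{i=1}^t\|\widehat\nabla_iF(x_i)\|^2},\qquad x_{t+1}=x_t-\frac{\eta}{b_t}\widehat\nabla_tF(x_t).$$ Then $$\mathbb{E}\left[\frac{\sum_{t=1}^T (F(x_t)-F(x^*))}{T}\right]=O\left(\Big(1+\mathrm{poly}\big(\sigma^2\log T,\ \log(1+\sigma^2T\log T)\big)\Big)\Big(\frac1T+\frac{\sigma\sqrt{\log T}}{\sqrt T}\Big)\right).$$ Precisely: there is an absolute real polynomial $P$ in two variables such that for all $\gamma\in(0,1]$, $L,\eta,b_0>0$ and $R\ge0$ there is a constant $C>0$, depending only on $\gamma,L,\eta,b_0,R$ (not on $d$, $F$, the oracle, $\sigma$ or $T$), such that in every situation as above with $\|x_1-x^*\|\le R$ and for every integer $T\ge1$, the random variable $\frac1T\sum_{t=1}^T(F(x_t)-F(x^*))$ is integrable and $$\mathbb{E}\left[\frac{\sum_{t=1}^T (F(x_t)-F(x^*))}{T}\right]\le C\Big(1+P\big(\sigma^2\log T,\ \log(1+\sigma^2T\log T)\big)\Big)\Big(\frac1T+\frac{\sigma\sqrt{\log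 T}}{\sqrt T}\Big).$$ -/

import Mathlib

open MeasureTheory ProbabilityTheory
open scoped BigOperators

/-- `F` is `γ`-quasar convex with respect to its global minimizer `xstar`
(so that `F xstar = inf F`), with `γ ∈ (0, 1]`. -/
def IsQuasarConvex {d : ℕ} (γ : ℝ) (F : EuclideanSpace ℝ (Fin d) → ℝ)
    (xstar : EuclideanSpace ℝ (Fin d)) : Prop :=
  0 < γ ∧ γ ≤ 1 ∧ (∀ x, F xstar ≤ F x) ∧
    ∀ x, F x + (1 / γ) * inner ℝ (gradient F x) (xstar - x) ≤ F xstar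

/-- `L`-smoothness: the quadratic upper bound between any two points. -/
def IsSmoothWith {d : ℕ} (L : ℝ) (F : EuclideanSpace ℝ (Fin d) → ℝ) : Prop :=
  0 < L ∧ ∀ x y, F x ≤ F y + inner ℝ (gradient F y) (x - y) + L / 2 * ‖x - y‖ ^ 2

/-- A stochastic gradient oracle `g`, queried at the point `x` at step `t ≥ 1`, returns
`g x (z t)`, where `z t` is the fresh randomness of that step. -/
structure IsOracle {d : ℕ} {S Ω : Type*} [MeasurableSpace S] [MeasurableSpace Ω]
    (μ : Measure Ω) (g : EuclideanSpace ℝ (Fin d) → S → EuclideanSpace ℝ (Fin d))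
    (z : ℕ → Ω → S) : Prop where
  measurable_oracle : Measurable (Function.uncurry g)
  measurable_sample : ∀ t, Measurable (z t)
  /-- the randomness of a step is independent of the history -/
  indep : iIndepFun z μ

/-- Unbiasedness: `E[g(x, z_t)] = ∇F(x)` for every point `x` and every step `t ≥ 1`. -/
def IsUnbiasedOracle {d : ℕ} {S Ω : Type*} [MeasurableSpace Ω] (μ : Measure Ω)
    (F : EuclideanSpace ℝ (Fin d) → ℝ)
    (g : EuclideanSpace ℝ (Fin d) → S → EuclideanSpace ℝ (Fin d)) (z : ℕ → Ω → S) : Prop :=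
  ∀ t, 1 ≤ t → ∀ x, Integrable (fun ω => g x (z t ω)) μ ∧ ∫ ω, g x (z t ω) ∂μ = gradient F x

/-- Sub-Gaussian noise: `E[exp(‖g(x, z_t) - ∇F(x)‖² / σ²)] ≤ exp 1` for every `x` and `t ≥ 1`.
For `σ = 0` (where `a / 0` has to be read as `∞` for `a > 0`) this says that the noise vanishes
almost surely. -/
def HasSubGaussianNoise {d : ℕ} {S Ω : Type*} [MeasurableSpace Ω] (μ : Measure Ω)
    (F : EuclideanSpace ℝ (Fin d) → ℝ)
    (g : EuclideanSpace ℝ (Fin d) → S → EuclideanSpace ℝ (Fin d)) (z : ℕ → Ω → S)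
    (σ : ℝ) : Prop :=
  ∀ t, 1 ≤ t → ∀ x,
    (0 < σ →
      Integrable (fun ω => Real.exp (‖g x (z t ω) - gradient F x‖ ^ 2 / σ ^ 2)) μ ∧
      ∫ ω, Real.exp (‖g x (z t ω) - gradient F x‖ ^ 2 / σ ^ 2) ∂μ ≤ Real.exp 1) ∧
    (σ = 0 → ∀ᵐ ω ∂μ, g x (z t ω) = gradient F x)

namespace AdaGradNorm

variable {d : ℕ} {S : Type*}

/-- The state after `k` steps of AdaGradNorm run on the seeds `s 1, s 2, …`: the pair
`(x_{k+1}, b_0² + ∑_{i=1}^k ‖g(x_i, s_i)‖²)`. -/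
noncomputable def state (g : EuclideanSpace ℝ (Fin d) → S → EuclideanSpace ℝ (Fin d))
    (η b₀ : ℝ) (x₁ : EuclideanSpace ℝ (Fin d)) (s : ℕ → S) :
    ℕ → EuclideanSpace ℝ (Fin d) × ℝ
  | 0 => (x₁, b₀ ^ 2)
  | k + 1 =>
    let p := state g η b₀ x₁ s k
    let G := g p.1 (s (k + 1))
    (p.1 - (η / Real.sqrt (p.2 + ‖G‖ ^ 2)) • G, p.2 + ‖G‖ ^ 2)

/-- The iterate `x_t`, for `t ≥ 1`. -/
noncomputable def iter (g : EuclideanSpace ℝ (Fin d) → S → EuclideanSpace ℝ (Fin d))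
    (η b₀ : ℝ) (x₁ : EuclideanSpace ℝ (Fin d)) (s : ℕ → S) (t : ℕ) :
    EuclideanSpace ℝ (Fin d) :=
  (state g η b₀ x₁ s (t - 1)).1

/-- `b_t = √(b_0² + ∑_{i=1}^t ‖g(x_i, s_i)‖²)`. -/
noncomputable def scale (g : EuclideanSpace ℝ (Fin d) → S → EuclideanSpace ℝ (Fin d))
    (η b₀ : ℝ) (x₁ : EuclideanSpace ℝ (Fin d)) (s : ℕ → S) (t : ℕ) : ℝ :=
  Real.sqrt (b₀ ^ 2 + ∑ i ∈ Finset.Icc 1 t, ‖g (iter g η b₀ x₁ s i) (s i)‖ ^ 2)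

theorem iter_one (g : EuclideanSpace ℝ (Fin d) → S → EuclideanSpace ℝ (Fin d))
    (η b₀ : ℝ) (x₁ : EuclideanSpace ℝ (Fin d)) (s : ℕ → S) :
    iter g η b₀ x₁ s 1 = x₁ := rfl

theorem state_snd (g : EuclideanSpace ℝ (Fin d) → S → EuclideanSpace ℝ (Fin d))
    (η b₀ : ℝ) (x₁ : EuclideanSpace ℝ (Fin d)) (s : ℕ → S) (t : ℕ) :
    (state g η b₀ x₁ s t).2 =
      b₀ ^ 2 + ∑ i ∈ Finset.Icc 1 t, ‖g (iter g η b₀ x₁ s i) (s i)‖ ^ 2 := by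
  induction t with
  | zero => simp [state]
  | succ k ih =>
    rw [Finset.sum_Icc_succ_top (by omega), ← add_assoc, ← ih]
    rfl

/-- The AdaGradNorm step: `x_{t+1} = x_t - (η / b_t) g(x_t, s_t)`. -/
theorem iter_succ (g : EuclideanSpace ℝ (Fin d) → S → EuclideanSpace ℝ (Fin d))
    (η b₀ : ℝ) (x₁ : EuclideanSpace ℝ (Fin d)) (s : ℕ → S) (t : ℕ) (ht : 1 ≤ t) :
    iter g η b₀ x₁ s (t + 1) = iter g η b₀ x₁ s t -
      (η / scale g η b₀ x₁ s t) • g (iter g η b₀ x₁ s t) (s t) := by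
  obtain ⟨k, rfl⟩ : ∃ k, t = k + 1 := ⟨t - 1, by omega⟩
  unfold scale
  rw [← state_snd]
  rfl

end AdaGradNorm

-- Write D for the distance to the minimizer, δ for the gap, n, a, e for the norms of the gradient,
-- the stochastic gradient and the noise, and B for the squared scale. The step size 1/b_t depends
-- on the current sample. It is replaced by 1/c with c² = B + n², which depends on the past only.
-- Since |b - c| ≤ e, this costs η D (e²/c² + a²/b²), and quasar convexity gives, with y a
-- martingale increment, D_{k+1}² + 2ηγ δ_k/c_k ≤ D_k² + y_k + η D_k (e²/c² + a²/b²) + η² a²/b².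
--
-- Pathwise: ∑ a²/b² ≤ l = log(B_T/B_0). With W = ∑ e²/c² and m the maximal partial sum of y,
-- absorbing the largest distance shows that every D_k² and the drift ∑ δ/c are O(Q), where Q = 1 +
-- m + W² + l². Smoothness gives n² ≤ 2Lδ, so B_T is controlled by the noise Ξ = ∑ e² and by ∑ δ
-- itself. Solving the resulting quadratic inequality gives ∑ δ = O(Q² + Q√Ξ) and l = O(1 + log(1 +
-- Ξ) + log Q). This is `exists_path_bound`.
--
-- In expectation it remains to bound E Q² by the noise alone (`exists_integral_envelope_sq_le`): -
-- Doob's inequality and y² ≤ 4η² D² e²/c² give E m² ≲ E[Q W], and half of E m² is absorbed. -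
-- Unbiasedness makes e² conditionally no larger in mean than a², so E W⁴ is comparable to E(∑
-- a²/c²)⁴ up to the maximal noise s. Pathwise, ∑ a²/c² ≲ (1 + s) l. - The eighth power of log Q is
-- at most εQ² plus a constant, so E l⁸ costs only a small multiple of E Q². These three bounds
-- close up (`moment_system`). Absorption is legitimate because all moments are finite: each step of
-- the algorithm moves by at most η. The sub-Gaussian tails then bound E s⁸, E log⁸(1 + Ξ) and E Ξ ≲
-- σ²T, and a weighted Young inequality for E[Q√Ξ] yields the rate.

universe u

namespace AdaGradNorm

/-! ### Pathwise inequalities: running maxima, logarithmic sums, the one-step estimate. -/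

/-- Running maximum of `0` and the first `k` terms of a sequence. -/
def runMax (f : ℕ → ℝ) : ℕ → ℝ
  | 0 => 0
  | k + 1 => max (runMax f k) (f k)

theorem runMax_nonneg (f : ℕ → ℝ) (k : ℕ) : 0 ≤ runMax f k := by
  induction k with
  | zero => exact le_rfl
  | succ k ih => exact le_max_of_le_left ih

theorem runMax_mono (f : ℕ → ℝ) : Monotone (runMax f) :=
  monotone_nat_of_le_succ fun _ => le_max_left _ _

theorem le_runMax (f : ℕ → ℝ) {i k : ℕ} (h : i < k) : f i ≤ runMax f k :=
  (le_max_right (runMax f i) (f i)).trans (runMax_mono f (Nat.succ_le_of_lt h))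

theorem runMax_le_sum_abs (f : ℕ → ℝ) (k : ℕ) : runMax f k ≤ ∑ i ∈ Finset.range k, |f i| := by
  induction k with
  | zero => simp [runMax]
  | succ k ih =>
    rw [Finset.sum_range_succ]
    have h0 : 0 ≤ ∑ i ∈ Finset.range k, |f i| := Finset.sum_nonneg fun _ _ => abs_nonneg _
    exact max_le (ih.trans (by linarith [abs_nonneg (f k)])) (by linarith [le_abs_self (f k)])

/-- A deterministic form of Doob's `L²` maximal inequality. -/
theorem runMax_sq_le (y : ℕ → ℝ) (k : ℕ) :
    runMax (fun j => ∑ i ∈ Finset.range (j + 1), y i) k ^ 2 ≤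
      2 * runMax (fun j => ∑ i ∈ Finset.range (j + 1), y i) k * (∑ i ∈ Finset.range k, y i)
        - 2 * ∑ i ∈ Finset.range k,
          runMax (fun j => ∑ i ∈ Finset.range (j + 1), y i) i * y i := by
  induction k with
  | zero => simp [runMax]
  | succ k ih =>
    rw [Finset.sum_range_succ (fun i => runMax _ i * y i)]
    change max _ _ ^ 2 ≤ 2 * max _ _ * _ - _
    have hs : runMax (fun j => ∑ i ∈ Finset.range (j + 1), y i) k * ∑ i ∈ Finset.range (k + 1), y i
        = runMax (fun j => ∑ i ∈ Finset.range (j + 1), y i) k * ∑ i ∈ Finset.range k, y i +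
          runMax (fun j => ∑ i ∈ Finset.range (j + 1), y i) k * y k := by
      rw [Finset.sum_range_succ]
      ring
    -- At a new maximum the claim reduces to 2uv ≤ u² + v². Otherwise the maximum is unchanged and
    -- the two terms in `y k` cancel.
    rcases le_total (runMax (fun j => ∑ i ∈ Finset.range (j + 1), y i) k)
      (∑ i ∈ Finset.range (k + 1), y i) with h | h
    · simp only [max_eq_right h]
      linarith [two_mul_le_add_sq (∑ i ∈ Finset.range (k + 1), y i)
        (runMax (fun j => ∑ i ∈ Finset.range (j + 1), y i) k)]
    · simp only [max_eq_left h]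
      linarith

/-- Each term equals 1 - B_k/B_{k+1}, which is at most log(B_{k+1}/B_k), and the logarithms
telescope. -/
theorem sum_div_le_log {a B : ℕ → ℝ} (h0 : 0 < B 0) (ha : ∀ k, 0 ≤ a k)
    (hB : ∀ k, B (k + 1) = B k + a k) (k : ℕ) :
    0 < B k ∧ ∑ i ∈ Finset.range k, a i / B (i + 1) ≤ Real.log (B k / B 0) := by
  induction k with
  | zero => simp [h0.ne', h0]
  | succ k ih =>
    obtain ⟨hk, ih⟩ := ih
    have hk' : 0 < B (k + 1) := by rw [hB]; linarith [ha k]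
    refine ⟨hk', ?_⟩
    rw [Finset.sum_range_succ]
    have h1 : Real.log (B (k + 1) / B 0) =
        Real.log (B k / B 0) - Real.log (B k / B (k + 1)) := by
      rw [Real.log_div hk'.ne' h0.ne', Real.log_div hk.ne' h0.ne', Real.log_div hk.ne' hk'.ne']
      ring
    have h2 := Real.log_le_sub_one_of_pos (div_pos hk hk')
    have h3 : a k / B (k + 1) = 1 - B k / B (k + 1) := by
      field_simp
      linarith [hB k]
    linarith

/-- One AdaGradNorm step with the step size decorrelated: the step uses `1 / b`, the martingale
term uses `1 / c`, which depends on the past only. -/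
theorem step_bound {E : Type*} [NormedAddCommGroup E] [InnerProductSpace ℝ E] {y G n : E}
    {η b c γ δ B : ℝ} (hη : 0 < η) (hb : 0 < b) (hc : 0 < c) (hB : 0 ≤ B)
    (hb2 : b ^ 2 = B + ‖G‖ ^ 2) (hc2 : c ^ 2 = B + ‖n‖ ^ 2) (hδ : γ * δ ≤ inner ℝ n y) :
    ‖y - (η / b) • G‖ ^ 2 + 2 * η * γ * (δ / c) ≤
      ‖y‖ ^ 2 + (-(2 * η / c) * inner ℝ (G - n) y)
        + η * ‖y‖ * (‖G - n‖ ^ 2 / c ^ 2 + ‖G‖ ^ 2 / b ^ 2) + η ^ 2 * (‖G‖ ^ 2 / b ^ 2) := by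
  have hGb : ‖G‖ ≤ b := abs_le_of_sq_le_sq' (by linarith) hb.le |>.2
  have hnc : ‖n‖ ≤ c := abs_le_of_sq_le_sq' (by linarith) hc.le |>.2
  -- b² - c² = ‖G‖² - ‖n‖², while b + c ≥ ‖G‖ + ‖n‖; divide by b + c.
  have hbc : |b - c| ≤ ‖G - n‖ := by
    have h1 : |b - c| * (b + c) = |‖G‖ - ‖n‖| * (‖G‖ + ‖n‖) := by
      have h4 : |(b - c) * (b + c)| = |(‖G‖ - ‖n‖) * (‖G‖ + ‖n‖)| := by
        congr 1
        linarith
      rwa [abs_mul, abs_mul, abs_of_pos (add_pos hb hc),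
        abs_of_nonneg (add_nonneg (norm_nonneg G) (norm_nonneg n))] at h4
    have h2 := abs_norm_sub_norm_le G n
    have h3 : |b - c| * (b + c) ≤ ‖G - n‖ * (b + c) := by
      rw [h1]
      gcongr
    exact le_of_mul_le_mul_right h3 (by positivity)
  have hexp : ‖y - (η / b) • G‖ ^ 2 =
      ‖y‖ ^ 2 - 2 * η / b * inner ℝ G y + η ^ 2 * (‖G‖ ^ 2 / b ^ 2) := by
    rw [norm_sub_sq_real, inner_smul_right, norm_smul, mul_pow, Real.norm_eq_abs, sq_abs,
      real_inner_comm]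
    ring
  -- The price of decorrelation: a product of the two normalized quantities e/c and a/b, both of
  -- which have summable squares up to logarithmic size.
  have hdiff : (1 / c - 1 / b) * inner ℝ G y ≤
      ‖y‖ * ((‖G - n‖ ^ 2 / c ^ 2 + ‖G‖ ^ 2 / b ^ 2) / 2) := by
    calc (1 / c - 1 / b) * inner ℝ G y ≤ |1 / c - 1 / b| * (‖G‖ * ‖y‖) := by
          refine (le_abs_self _).trans ?_
          rw [abs_mul]
          gcongr
          exact abs_real_inner_le_norm G y
      _ = |b - c| / c * (‖G‖ / b) * ‖y‖ := by
          have : 1 / c - 1 / b = (b - c) / (c * b) := by field_simp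
          rw [this, abs_div, abs_of_pos (mul_pos hc hb)]
          field_simp
      _ ≤ ‖G - n‖ / c * (‖G‖ / b) * ‖y‖ := by gcongr
      _ ≤ _ := by
          rw [mul_comm _ ‖y‖]
          gcongr
          rw [← div_pow, ← div_pow]
          linarith [two_mul_le_add_sq (‖G - n‖ / c) (‖G‖ / b)]
  have hdrift : γ * (δ / c) ≤ 1 / c * inner ℝ n y := by
    have := div_le_div_of_nonneg_right hδ hc.le
    calc γ * (δ / c) = γ * δ / c := by ring
      _ ≤ _ := this
      _ = _ := by ring
  have key : 2 * η * ((1 / c - 1 / b) * inner ℝ G y) ≤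
      2 * η * (‖y‖ * ((‖G - n‖ ^ 2 / c ^ 2 + ‖G‖ ^ 2 / b ^ 2) / 2)) := by gcongr
  have key2 : 2 * η * (γ * (δ / c)) ≤ 2 * η * (1 / c * inner ℝ n y) := by gcongr
  rw [hexp, inner_sub_left]
  have e1 : 2 * η * ((1 / c - 1 / b) * inner ℝ G y) =
    2 * η / c * inner ℝ G y - 2 * η / b * inner ℝ G y := by ring
  have e2 : 2 * η * (1 / c * inner ℝ n y) = 2 * η / c * inner ℝ n y := by ring
  rw [e1] at key
  rw [e2] at key2
  linarith

/-! ### Smoothness at a global minimizer. -/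

section Smooth

variable {d : ℕ} {F : EuclideanSpace ℝ (Fin d) → ℝ} {xstar : EuclideanSpace ℝ (Fin d)} {L : ℝ}

/-- A gradient step of length 1/L decreases F by at least ‖∇F‖²/(2L), and it cannot go below the
minimum. -/
theorem norm_gradient_sq_le (hF : IsSmoothWith L F) (hmin : ∀ x, F xstar ≤ F x)
    (x : EuclideanSpace ℝ (Fin d)) : ‖gradient F x‖ ^ 2 ≤ 2 * L * (F x - F xstar) := by
  obtain ⟨hL, h⟩ := hF
  have h1 := h (x - (1 / L) • gradient F x) x
  have h2 := hmin (x - (1 / L) • gradient F x)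
  rw [sub_sub_cancel_left, inner_neg_right, inner_smul_right, real_inner_self_eq_norm_sq,
    norm_neg, norm_smul, mul_pow, Real.norm_eq_abs, sq_abs] at h1
  have h3 : L / 2 * ((1 / L) ^ 2 * ‖gradient F x‖ ^ 2) = 1 / (2 * L) * ‖gradient F x‖ ^ 2 := by
    field_simp
  have h4 : 1 / L * ‖gradient F x‖ ^ 2 = 2 * (1 / (2 * L) * ‖gradient F x‖ ^ 2) := by
    field_simp
  have h5 : 1 / (2 * L) * ‖gradient F x‖ ^ 2 ≤ F x - F xstar := by linarith
  calc ‖gradient F x‖ ^ 2 = 2 * L * (1 / (2 * L) * ‖gradient F x‖ ^ 2) := by field_simp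
    _ ≤ _ := by gcongr

theorem sub_min_le (hF : IsSmoothWith L F) (hmin : ∀ x, F xstar ≤ F x)
    (x : EuclideanSpace ℝ (Fin d)) : F x - F xstar ≤ L / 2 * ‖x - xstar‖ ^ 2 := by
  have h0 := norm_gradient_sq_le hF hmin xstar
  rw [sub_self, mul_zero] at h0
  have h1 : gradient F xstar = 0 := by
    rw [← norm_eq_zero]
    exact pow_eq_zero_iff two_ne_zero |>.1 (le_antisymm h0 (sq_nonneg _))
  have h2 := hF.2 x xstar
  rw [h1, inner_zero_left] at h2
  linarith

theorem norm_gradient_sq_le' (hF : IsSmoothWith L F) (hmin : ∀ x, F xstar ≤ F x)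
    (x : EuclideanSpace ℝ (Fin d)) : ‖gradient F x‖ ^ 2 ≤ L ^ 2 * ‖x - xstar‖ ^ 2 := by
  have hL := hF.1
  calc ‖gradient F x‖ ^ 2 ≤ 2 * L * (F x - F xstar) := norm_gradient_sq_le hF hmin x
    _ ≤ 2 * L * (L / 2 * ‖x - xstar‖ ^ 2) := by
        gcongr
        exact sub_min_le hF hmin x
    _ = _ := by ring

end Smooth

/-! ### Deterministic analysis of a trajectory. -/

/-- Real sequences attached to a trajectory: distances `D` to the minimizer, gaps `δ`, norms `a`,
`n`, `e` of the stochastic gradient, of the gradient and of the noise, squared scales `B` and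
martingale increments `y`. -/
structure Path (γ L η b₀ R : ℝ) (D δ a n e B y : ℕ → ℝ) : Prop where
  D_nonneg : ∀ k, 0 ≤ D k
  δ_nonneg : ∀ k, 0 ≤ δ k
  a_nonneg : ∀ k, 0 ≤ a k
  n_nonneg : ∀ k, 0 ≤ n k
  e_nonneg : ∀ k, 0 ≤ e k
  a_le : ∀ k, a k ≤ n k + e k
  n_sq_le_gap : ∀ k, n k ^ 2 ≤ 2 * L * δ k
  n_sq_le_dist : ∀ k, n k ^ 2 ≤ L ^ 2 * D k ^ 2
  D_zero : D 0 ≤ R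
  B_zero : B 0 = b₀ ^ 2
  B_succ : ∀ k, B (k + 1) = B k + a k ^ 2
  step : ∀ k, D (k + 1) ^ 2 + 2 * η * γ * (δ k / √(B k + n k ^ 2)) ≤ D k ^ 2 + y k
    + η * D k * (e k ^ 2 / (B k + n k ^ 2) + a k ^ 2 / B (k + 1)) + η ^ 2 * (a k ^ 2 / B (k + 1))

/-- Accumulated normalized squares, `∑_{k < T} f_k² / (B_k + n_k²)`. -/
noncomputable def normSum (f n B : ℕ → ℝ) (T : ℕ) : ℝ :=
  ∑ k ∈ Finset.range T, f k ^ 2 / (B k + n k ^ 2)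

/-- Running maximum of the partial sums of `y`. -/
noncomputable def maxSum (y : ℕ → ℝ) (T : ℕ) : ℝ :=
  runMax (fun j => ∑ i ∈ Finset.range (j + 1), y i) T

theorem maxSum_nonneg (y : ℕ → ℝ) (T : ℕ) : 0 ≤ maxSum y T := runMax_nonneg _ _

theorem sum_le_maxSum (y : ℕ → ℝ) {k T : ℕ} (h : k ≤ T) :
    ∑ i ∈ Finset.range k, y i ≤ maxSum y T := by
  rcases k with _ | k
  · simpa using maxSum_nonneg y T
  · exact le_runMax (fun j => ∑ i ∈ Finset.range (j + 1), y i) h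

/-- The random factor which controls the squared distances up to time `T`. -/
noncomputable def envelope (e n B y : ℕ → ℝ) (T : ℕ) : ℝ :=
  1 + maxSum y T + normSum e n B T ^ 2 + Real.log (B T / B 0) ^ 2

theorem one_le_envelope (e n B y : ℕ → ℝ) (T : ℕ) : 1 ≤ envelope e n B y T := by
  unfold envelope
  linarith [maxSum_nonneg y T, sq_nonneg (normSum e n B T), sq_nonneg (Real.log (B T / B 0))]

namespace Path

variable {γ L η b₀ R : ℝ} {D δ a n e B y : ℕ → ℝ}

theorem B_zero_pos (h : Path γ L η b₀ R D δ a n e B y) (hb : 0 < b₀) : 0 < B 0 := by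
  rw [h.B_zero]
  positivity

theorem B_pos (h : Path γ L η b₀ R D δ a n e B y) (hb : 0 < b₀) (k : ℕ) : 0 < B k :=
  (sum_div_le_log (h.B_zero_pos hb) (fun k => sq_nonneg (a k)) h.B_succ k).1

theorem sum_le_log (h : Path γ L η b₀ R D δ a n e B y) (hb : 0 < b₀) (k : ℕ) :
    ∑ i ∈ Finset.range k, a i ^ 2 / B (i + 1) ≤ Real.log (B k / B 0) :=
  (sum_div_le_log (h.B_zero_pos hb) (fun k => sq_nonneg (a k)) h.B_succ k).2

theorem B_mono (h : Path γ L η b₀ R D δ a n e B y) : Monotone B :=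
  monotone_nat_of_le_succ fun k => by rw [h.B_succ]; linarith [sq_nonneg (a k)]

theorem log_nonneg (h : Path γ L η b₀ R D δ a n e B y) (hb : 0 < b₀) (k : ℕ) :
    0 ≤ Real.log (B k / B 0) :=
  Real.log_nonneg ((one_le_div (h.B_zero_pos hb)).2 (h.B_mono (Nat.zero_le k)))

theorem normSum_nonneg (h : Path γ L η b₀ R D δ a n e B y) (hb : 0 < b₀) (f : ℕ → ℝ) (k : ℕ) :
    0 ≤ normSum f n B k :=
  Finset.sum_nonneg fun i _ =>
    div_nonneg (sq_nonneg _) (add_nonneg (h.B_pos hb i).le (sq_nonneg _))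

theorem dist_sq_add_sum_le (h : Path γ L η b₀ R D δ a n e B y) (hη : 0 < η) (hb : 0 < b₀)
    {d : ℝ} {T : ℕ} (hd : ∀ i ≤ T, D i ≤ d) {k : ℕ} (hk : k ≤ T) :
    D k ^ 2 + 2 * η * γ * ∑ i ∈ Finset.range k, δ i / √(B i + n i ^ 2) ≤
      R ^ 2 + ∑ i ∈ Finset.range k, y i +
        η * d * (normSum e n B k + ∑ i ∈ Finset.range k, a i ^ 2 / B (i + 1)) +
        η ^ 2 * ∑ i ∈ Finset.range k, a i ^ 2 / B (i + 1) := by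
  induction k with
  | zero =>
    have := pow_le_pow_left₀ (h.D_nonneg 0) h.D_zero 2
    simpa [normSum] using this
  | succ k ih =>
    have ih := ih (by omega)
    have hs := h.step k
    have hBk := h.B_pos hb k
    have hBk' := h.B_pos hb (k + 1)
    have hx : η * D k * (e k ^ 2 / (B k + n k ^ 2) + a k ^ 2 / B (k + 1)) ≤
        η * d * (e k ^ 2 / (B k + n k ^ 2) + a k ^ 2 / B (k + 1)) := by
      have := hd k (by omega)
      gcongr
    rw [normSum] at ih ⊢
    simp only [Finset.sum_range_succ] at ih ⊢
    linarith

theorem exists_dist_bound (h : Path γ L η b₀ R D δ a n e B y) (T : ℕ) :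
    ∃ d, 0 ≤ d ∧ (∀ i ≤ T, D i ≤ d) ∧ ∃ i ≤ T, D i = d := by
  obtain ⟨i, hi, hmax⟩ := Finset.exists_max_image (Finset.range (T + 1)) D ⟨0, by simp⟩
  exact ⟨D i, h.D_nonneg i, fun j hj => hmax j (by simp; omega), i, by simp at hi; omega, rfl⟩

theorem dist_and_drift_le (h : Path γ L η b₀ R D δ a n e B y) (hγ : 0 < γ) (hη : 0 < η)
    (hb : 0 < b₀) (T : ℕ) :
    (∀ k ≤ T, D k ^ 2 ≤ 2 * (R ^ 2 + 1 + 3 * η ^ 2) * envelope e n B y T) ∧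
      2 * η * γ * ∑ i ∈ Finset.range T, δ i / √(B i + n i ^ 2) ≤
        2 * (R ^ 2 + 1 + 3 * η ^ 2) * envelope e n B y T := by
  obtain ⟨d, hd0, hd, i, hi, hid⟩ := h.exists_dist_bound T
  have hdrift : ∀ k, 0 ≤ 2 * η * γ * ∑ i ∈ Finset.range k, δ i / √(B i + n i ^ 2) := fun k =>
    mul_nonneg (by positivity)
      (Finset.sum_nonneg fun i _ => div_nonneg (h.δ_nonneg i) (Real.sqrt_nonneg _))
  set W := normSum e n B T with hW
  set l := Real.log (B T / B 0) with hl
  set m := maxSum y T with hm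
  have hW0 : 0 ≤ W := h.normSum_nonneg hb e T
  have hl0 : 0 ≤ l := h.log_nonneg hb T
  have hm0 : 0 ≤ m := maxSum_nonneg y T
  have main : ∀ k ≤ T, D k ^ 2 + 2 * η * γ * ∑ i ∈ Finset.range k, δ i / √(B i + n i ^ 2) ≤
      R ^ 2 + m + η * d * (W + l) + η ^ 2 * l := by
    intro k hk
    refine (h.dist_sq_add_sum_le hη hb hd hk).trans ?_
    have h1 : ∑ i ∈ Finset.range k, y i ≤ m := sum_le_maxSum y hk
    have h2 : normSum e n B k ≤ W :=
      Finset.sum_le_sum_of_subset_of_nonneg (Finset.range_mono hk) fun i _ _ =>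
        div_nonneg (sq_nonneg _) (add_nonneg (h.B_pos hb i).le (sq_nonneg _))
    have h3 : ∑ i ∈ Finset.range k, a i ^ 2 / B (i + 1) ≤ l :=
      (Finset.sum_le_sum_of_subset_of_nonneg (Finset.range_mono hk) fun i _ _ =>
        div_nonneg (sq_nonneg _) (h.B_pos hb _).le).trans (h.sum_le_log hb T)
    gcongr
  -- Here d is attained as one of the distances, so half of d² can be moved to the left-hand side.
  have hprod : η * d * (W + l) ≤ d ^ 2 / 2 + η ^ 2 * (W + l) ^ 2 / 2 := by
    nlinarith [sq_nonneg (d - η * (W + l))]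
  have hd2 : d ^ 2 ≤ 2 * (R ^ 2 + m + η ^ 2 * (W + l) ^ 2 / 2 + η ^ 2 * l) := by
    have := main i hi
    rw [hid] at this
    linarith [hdrift i]
  -- The 3 comes from (W + l)² + l ≤ 1 + 2W² + 3l².
  have hQ : 2 * (R ^ 2 + m + η ^ 2 * (W + l) ^ 2 + η ^ 2 * l) ≤
      2 * (R ^ 2 + 1 + 3 * η ^ 2) * envelope e n B y T := by
    have e1 : (W + l) ^ 2 ≤ 2 * (W ^ 2 + l ^ 2) := by nlinarith [sq_nonneg (W - l)]
    have e2 : l ≤ 1 + l ^ 2 := by nlinarith [sq_nonneg (l - 1)]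
    have e3 : η ^ 2 * (W + l) ^ 2 ≤ η ^ 2 * (2 * (W ^ 2 + l ^ 2)) := by gcongr
    have e4 : η ^ 2 * l ≤ η ^ 2 * (1 + l ^ 2) := by gcongr
    have e5 : envelope e n B y T = 1 + m + W ^ 2 + l ^ 2 := rfl
    rw [e5]
    have p1 : 0 ≤ R ^ 2 * (m + W ^ 2 + l ^ 2) := by positivity
    have p2 : 0 ≤ η ^ 2 * m := by positivity
    have p3 : 0 ≤ η ^ 2 * W ^ 2 := by positivity
    nlinarith [sq_nonneg W, sq_nonneg l, sq_nonneg η]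
  have hη2 : 0 ≤ η ^ 2 * (W + l) ^ 2 := by positivity
  refine ⟨fun k hk => ?_, ?_⟩
  · have := pow_le_pow_left₀ (h.D_nonneg k) (hd k hk) 2
    linarith
  · have := main T le_rfl
    linarith [sq_nonneg (D T)]

/-- Removes the normalization from the drift: every c_i is at most a common bound, by monotonicity
of B and by n ≤ L D. -/
theorem sum_gap_le_sqrt_mul (h : Path γ L η b₀ R D δ a n e B y) (hb : 0 < b₀) {A q : ℝ}
    (T : ℕ) (hD : ∀ k ≤ T, D k ^ 2 ≤ A * q) :
    ∑ i ∈ Finset.range T, δ i ≤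
      √(B T + L ^ 2 * (A * q)) * ∑ i ∈ Finset.range T, δ i / √(B i + n i ^ 2) := by
  rw [Finset.mul_sum]
  refine Finset.sum_le_sum fun i hi => ?_
  have hi := Finset.mem_range.1 hi
  have hpos : 0 < √(B i + n i ^ 2) := Real.sqrt_pos.2 (by linarith [h.B_pos hb i, sq_nonneg (n i)])
  have hle : √(B i + n i ^ 2) ≤ √(B T + L ^ 2 * (A * q)) := by
    refine Real.sqrt_le_sqrt (add_le_add (h.B_mono hi.le) ((h.n_sq_le_dist i).trans ?_))
    exact mul_le_mul_of_nonneg_left (hD i hi.le) (sq_nonneg L)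
  calc δ i = √(B i + n i ^ 2) * (δ i / √(B i + n i ^ 2)) := by field_simp
    _ ≤ _ := mul_le_mul_of_nonneg_right hle (div_nonneg (h.δ_nonneg i) hpos.le)

/-- Self-bounding: a² ≤ 2n² + 2e² and n² ≤ 2Lδ, so the scale can be large only through the noise or
through the gaps being estimated. -/
theorem B_le (h : Path γ L η b₀ R D δ a n e B y) (T : ℕ) :
    B T ≤ b₀ ^ 2 + 2 * ∑ i ∈ Finset.range T, e i ^ 2 + 4 * L * ∑ i ∈ Finset.range T, δ i := by
  induction T with
  | zero => simp [h.B_zero]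
  | succ k ih =>
    rw [h.B_succ, Finset.sum_range_succ, Finset.sum_range_succ]
    have h1 : a k ^ 2 ≤ (n k + e k) ^ 2 := pow_le_pow_left₀ (h.a_nonneg k) (h.a_le k) 2
    have h2 : (n k + e k) ^ 2 ≤ 2 * n k ^ 2 + 2 * e k ^ 2 := by nlinarith [sq_nonneg (n k - e k)]
    linarith [h.n_sq_le_gap k]

/-- The logarithmic bound is for the denominators B_{i+1}, which contain the current sample. They
exceed B_i + n_i² by a factor of at most 2(1 + s/b₀²), with s the largest squared noise. -/
theorem normSum_le (h : Path γ L η b₀ R D δ a n e B y) (hb : 0 < b₀) (T : ℕ) :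
    normSum a n B T ≤
      2 * (1 + runMax (fun k => e k ^ 2) T / b₀ ^ 2) * Real.log (B T / B 0) := by
  set s := runMax (fun k => e k ^ 2) T
  have hs : 0 ≤ s := runMax_nonneg _ _
  refine le_trans ?_ (mul_le_mul_of_nonneg_left (h.sum_le_log hb T) (by positivity))
  rw [Finset.mul_sum]
  refine Finset.sum_le_sum fun i hi => ?_
  have hB := h.B_pos hb i
  have hB0 : b₀ ^ 2 ≤ B i := h.B_zero ▸ h.B_mono (Nat.zero_le i)
  have hes : e i ^ 2 ≤ s := le_runMax (fun k => e k ^ 2) (Finset.mem_range.1 hi)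
  have hc : 0 < B i + n i ^ 2 := by positivity
  have h1 : B (i + 1) ≤ 2 * (1 + s / b₀ ^ 2) * (B i + n i ^ 2) := by
    have h2 : a i ^ 2 ≤ (n i + e i) ^ 2 := pow_le_pow_left₀ (h.a_nonneg i) (h.a_le i) 2
    have h3 : s ≤ s / b₀ ^ 2 * (B i + n i ^ 2) := by
      calc s = s / b₀ ^ 2 * b₀ ^ 2 := by field_simp
        _ ≤ _ := by
          gcongr
          linarith [sq_nonneg (n i)]
    rw [h.B_succ]
    nlinarith [sq_nonneg (n i - e i)]
  rw [div_le_iff₀ hc]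
  have hB1 := h.B_pos hb (i + 1)
  calc a i ^ 2 = a i ^ 2 / B (i + 1) * B (i + 1) := by field_simp
    _ ≤ a i ^ 2 / B (i + 1) * (2 * (1 + s / b₀ ^ 2) * (B i + n i ^ 2)) := by gcongr
    _ = _ := by ring

theorem div_le_runMax (h : Path γ L η b₀ R D δ a n e B y) (hb : 0 < b₀) {i T : ℕ} (hi : i < T) :
    e i ^ 2 / (B i + n i ^ 2) ≤ runMax (fun k => e k ^ 2) T / b₀ ^ 2 := by
  have hB0 : b₀ ^ 2 ≤ B i := h.B_zero ▸ h.B_mono (Nat.zero_le i)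
  have hes : e i ^ 2 ≤ runMax (fun k => e k ^ 2) T := le_runMax (fun k => e k ^ 2) hi
  exact div_le_div₀ (runMax_nonneg _ _) hes (by positivity) (by linarith [sq_nonneg (n i)])

end Path

theorem le_add_sqrt_of_sq_le {x p q : ℝ} (hp : 0 ≤ p) (hq : 0 ≤ q) (h : x ^ 2 ≤ p * x + q) :
    x ≤ p + √q := by
  by_contra! hx
  nlinarith [Real.sq_sqrt hq, Real.sqrt_nonneg q]

/-- Deterministic consequences of the recursion, in terms of the envelope and of the noise. -/
theorem exists_path_bound {γ L η b₀ R : ℝ} (hγ : 0 < γ) (hL : 0 < L) (hη : 0 < η)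
    (hb : 0 < b₀) : ∃ C : ℝ, 1 ≤ C ∧ ∀ (D δ a n e B y : ℕ → ℝ),
      Path γ L η b₀ R D δ a n e B y → ∀ T : ℕ,
        (∀ k ≤ T, D k ^ 2 ≤ C * envelope e n B y T) ∧
        ∑ i ∈ Finset.range T, δ i ≤ C * (envelope e n B y T ^ 2 +
          envelope e n B y T * √(∑ i ∈ Finset.range T, e i ^ 2)) ∧
        Real.log (B T / B 0) ≤ C * (1 + Real.log (1 + ∑ i ∈ Finset.range T, e i ^ 2)
          + Real.log (envelope e n B y T)) := by
  set A := 2 * (R ^ 2 + 1 + 3 * η ^ 2) with hA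
  have hA1 : 1 ≤ A := by nlinarith [sq_nonneg R, sq_nonneg η]
  -- K bounds the drift by KQ, C₁ comes from solving the quadratic inequality for ∑ δ, and C₂ from
  -- inserting that solution in `B_le`.
  set K := A / (2 * η * γ) with hK
  have hK0 : 0 < K := by positivity
  set C₁ := 4 * L * K ^ 2 + K * (b₀ + L * A) + 2 * K with hC₁
  have hC₁0 : 0 < C₁ := by positivity
  set C₂ := (b₀ ^ 2 + 2 + 8 * L * C₁) / b₀ ^ 2 with hC₂
  have hC₂1 : 1 ≤ C₂ := by
    rw [hC₂, one_le_div (by positivity)]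
    have : 0 ≤ 8 * L * C₁ := by positivity
    linarith
  have hlC₂ : 0 ≤ Real.log C₂ := Real.log_nonneg hC₂1
  refine ⟨A + C₁ + Real.log C₂ + 2, by linarith, ?_⟩
  intro D δ a n e B y h T
  obtain ⟨h1, h2⟩ := h.dist_and_drift_le hγ hη hb T
  have hQ := one_le_envelope e n B y T
  set Q := envelope e n B y T with hQdef
  have hΞ : 0 ≤ ∑ i ∈ Finset.range T, e i ^ 2 := Finset.sum_nonneg fun _ _ => sq_nonneg _
  have hB := h.B_le T
  have hX : 0 ≤ ∑ i ∈ Finset.range T, δ i := Finset.sum_nonneg fun i _ => h.δ_nonneg i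
  have hXle := h.sum_gap_le_sqrt_mul hb T h1
  set Ξ := ∑ i ∈ Finset.range T, e i ^ 2 with hΞdef
  set X := ∑ i ∈ Finset.range T, δ i with hXdef
  set Z := ∑ i ∈ Finset.range T, δ i / √(B i + n i ^ 2) with hZdef
  have hZ : Z ≤ K * Q := by
    rw [hK, div_mul_eq_mul_div, le_div_iff₀ (by positivity)]
    linarith
  have hBT := h.B_pos hb T
  -- The bound X ≤ √(B_T + …)·KQ has B_T growing at most linearly in X; squaring turns it into a
  -- quadratic inequality for X.
  have hX2 : X ^ 2 ≤ (4 * L * (K * Q) ^ 2) * X +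
      (K * Q) ^ 2 * (b₀ ^ 2 + 2 * Ξ + L ^ 2 * (A * Q)) := by
    have h3 : X ≤ √(B T + L ^ 2 * (A * Q)) * (K * Q) :=
      hXle.trans (mul_le_mul_of_nonneg_left hZ (Real.sqrt_nonneg _))
    calc X ^ 2 ≤ (√(B T + L ^ 2 * (A * Q)) * (K * Q)) ^ 2 := pow_le_pow_left₀ hX h3 2
      _ = (K * Q) ^ 2 * (B T + L ^ 2 * (A * Q)) := by
        rw [mul_pow, Real.sq_sqrt (by positivity)]
        ring
      _ ≤ (K * Q) ^ 2 * ((b₀ ^ 2 + 2 * Ξ + 4 * L * X) + L ^ 2 * (A * Q)) := by gcongr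
      _ = _ := by ring
  have hXb : X ≤ C₁ * (Q ^ 2 + Q * √Ξ) := by
    refine (le_add_sqrt_of_sq_le (by positivity) (by positivity) hX2).trans ?_
    have h4 : √((K * Q) ^ 2 * (b₀ ^ 2 + 2 * Ξ + L ^ 2 * (A * Q))) ≤
        K * Q * (b₀ + 2 * √Ξ + L * (A * Q)) := by
      refine Real.sqrt_le_iff.2 ⟨by positivity, ?_⟩
      rw [mul_pow (K * Q)]
      gcongr
      have h5 := Real.sq_sqrt hΞ
      have h6 : L ^ 2 * (A * Q) ≤ L ^ 2 * (A * Q) ^ 2 := by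
        gcongr
        have : 1 ≤ A * Q := one_le_mul_of_one_le_of_one_le hA1 hQ
        nlinarith
      have h7 : 0 ≤ b₀ * √Ξ := by positivity
      have h8 : 0 ≤ b₀ * (L * (A * Q)) := by positivity
      have h9 : 0 ≤ √Ξ * (L * (A * Q)) := by positivity
      nlinarith
    have h10 : b₀ ≤ b₀ * Q := le_mul_of_one_le_right hb.le hQ
    have h11 : K * Q * (b₀ + 2 * √Ξ + L * (A * Q)) ≤ K * Q * (b₀ * Q + 2 * √Ξ + L * (A * Q)) := by
      gcongr
    have h12 : 0 ≤ 4 * L * K ^ 2 * (Q * √Ξ) := by positivity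
    have h13 : 0 ≤ K * (b₀ + L * A) * (Q * √Ξ) := by positivity
    have h14 : 0 ≤ 2 * K * Q ^ 2 := by positivity
    calc _ ≤ 4 * L * (K * Q) ^ 2 + K * Q * (b₀ * Q + 2 * √Ξ + L * (A * Q)) := by linarith
      _ ≤ _ := by
        rw [hC₁]
        linarith
  have hQs : Q * √Ξ ≤ Q ^ 2 + Ξ := by
    have h5 := Real.sq_sqrt hΞ
    have h6 : 0 ≤ Q * √Ξ := by positivity
    linarith [two_mul_le_add_sq Q (√Ξ)]
  have hBle : B T / B 0 ≤ C₂ * ((1 + Ξ) * Q ^ 2) := by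
    rw [h.B_zero, hC₂, div_mul_eq_mul_div]
    gcongr
    have h15 : X ≤ C₁ * (2 * ((1 + Ξ) * Q ^ 2)) := hXb.trans (by
      gcongr
      have h19 : 0 ≤ Ξ * (Q ^ 2 - 1) := mul_nonneg hΞ (by linarith [one_le_pow₀ hQ (n := 2)])
      linarith [sq_nonneg Q])
    have h16 : 4 * L * X ≤ 4 * L * (C₁ * (2 * ((1 + Ξ) * Q ^ 2))) := by gcongr
    have h17 : 1 + Ξ ≤ (1 + Ξ) * Q ^ 2 :=
      le_mul_of_one_le_right (by positivity) (one_le_pow₀ hQ)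
    have h18 : b₀ ^ 2 * 1 ≤ b₀ ^ 2 * ((1 + Ξ) * Q ^ 2) := by
      gcongr
      linarith
    linarith
  have hlog : Real.log (B T / B 0) ≤ Real.log C₂ + Real.log (1 + Ξ) + 2 * Real.log Q := by
    have hB00 := h.B_zero_pos hb
    refine (Real.log_le_log (by positivity) hBle).trans (le_of_eq ?_)
    rw [Real.log_mul (by positivity) (by positivity), Real.log_mul (by positivity) (by positivity),
      Real.log_pow]
    push_cast
    ring
  have hl1 : 0 ≤ Real.log (1 + Ξ) := Real.log_nonneg (by linarith)
  have hl2 : 0 ≤ Real.log Q := Real.log_nonneg hQ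
  refine ⟨fun k hk => (h1 k hk).trans ?_, hXb.trans ?_, hlog.trans ?_⟩
  · gcongr
    linarith
  · gcongr
    linarith
  · have h19 := mul_nonneg hlC₂ (add_nonneg hl1 hl2)
    have h20 : 0 ≤ (A + C₁) * (1 + Real.log (1 + Ξ) + Real.log Q) := by positivity
    linarith

/-! ### Random variables with all moments; maximal and fourth-moment inequalities. -/

section Moments

variable {Ω : Type*} [MeasurableSpace Ω] {μ : Measure Ω}

/-- A measurable real random variable all of whose absolute moments are finite. -/
structure HasMoments (X : Ω → ℝ) (μ : Measure Ω) : Prop where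
  measurable : Measurable X
  integrable_abs_pow : ∀ p : ℕ, Integrable (fun ω => |X ω| ^ p) μ

namespace HasMoments

variable {X Y : Ω → ℝ}

theorem integrable (hX : HasMoments X μ) : Integrable X μ := by
  have := hX.integrable_abs_pow 1
  simp only [pow_one] at this
  exact (integrable_norm_iff hX.measurable.aestronglyMeasurable).1 this

theorem of_abs_le (hY : HasMoments Y μ) (hX : Measurable X) (h : ∀ ω, |X ω| ≤ |Y ω|) :
    HasMoments X μ :=
  ⟨hX, fun p => (hY.integrable_abs_pow p).mono' (by fun_prop) (Filter.Eventually.of_forall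
    fun ω => by
      rw [Real.norm_eq_abs, abs_of_nonneg (by positivity)]
      exact pow_le_pow_left₀ (abs_nonneg _) (h ω) p)⟩

theorem of_le (hY : HasMoments Y μ) (hX : Measurable X) (h0 : ∀ ω, 0 ≤ X ω)
    (h : ∀ ω, X ω ≤ Y ω) : HasMoments X μ :=
  hY.of_abs_le hX fun ω => by
    rw [abs_of_nonneg (h0 ω)]
    exact (h ω).trans (le_abs_self _)

theorem mul (hX : HasMoments X μ) (hY : HasMoments Y μ) :
    HasMoments (fun ω => X ω * Y ω) μ := by
  refine ⟨hX.measurable.mul hY.measurable, fun p => ?_⟩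
  have hm := hX.measurable.mul hY.measurable
  refine ((hX.integrable_abs_pow (2 * p)).add (hY.integrable_abs_pow (2 * p))).mono'
    (by have := hX.measurable; have := hY.measurable; fun_prop)
    (Filter.Eventually.of_forall fun ω => ?_)
  rw [Real.norm_eq_abs, abs_of_nonneg (by positivity), abs_mul, mul_pow, Pi.add_apply, mul_comm 2 p,
    pow_mul, pow_mul]
  have h1 : 0 ≤ |X ω| ^ p := by positivity
  have h2 : 0 ≤ |Y ω| ^ p := by positivity
  nlinarith [sq_nonneg (|X ω| ^ p - |Y ω| ^ p)]

theorem add (hX : HasMoments X μ) (hY : HasMoments Y μ) :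
    HasMoments (fun ω => X ω + Y ω) μ := by
  refine ⟨hX.measurable.add hY.measurable, fun p => ?_⟩
  refine (((hX.integrable_abs_pow p).add (hY.integrable_abs_pow p)).const_mul
    (2 ^ (p - 1))).mono' (by have := hX.measurable; have := hY.measurable; fun_prop)
    (Filter.Eventually.of_forall fun ω => ?_)
  rw [Real.norm_eq_abs, abs_of_nonneg (by positivity)]
  exact (pow_le_pow_left₀ (abs_nonneg _) (abs_add_le _ _) p).trans
    (add_pow_le (abs_nonneg _) (abs_nonneg _) p)

theorem const [IsFiniteMeasure μ] (c : ℝ) : HasMoments (fun _ : Ω => c) μ :=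
  ⟨measurable_const, fun _ => integrable_const _⟩

theorem const_mul [IsFiniteMeasure μ] (hX : HasMoments X μ) (c : ℝ) :
    HasMoments (fun ω => c * X ω) μ := (const c).mul hX

theorem pow [IsFiniteMeasure μ] (hX : HasMoments X μ) (p : ℕ) :
    HasMoments (fun ω => X ω ^ p) μ := by
  induction p with
  | zero => simpa using const (μ := μ) 1
  | succ p ih => simpa only [pow_succ] using ih.mul hX

theorem abs (hX : HasMoments X μ) : HasMoments (fun ω => |X ω|) μ :=
  hX.of_abs_le (by have := hX.measurable; fun_prop) fun ω => by rw [abs_abs]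

theorem sum [IsFiniteMeasure μ] {X : ℕ → Ω → ℝ} (hX : ∀ k, HasMoments (X k) μ) (T : ℕ) :
    HasMoments (fun ω => ∑ k ∈ Finset.range T, X k ω) μ := by
  induction T with
  | zero => simpa using const (μ := μ) 0
  | succ T ih => simpa only [Finset.sum_range_succ] using ih.add (hX T)

theorem integral_add (hX : HasMoments X μ) (hY : HasMoments Y μ) :
    ∫ ω, (X ω + Y ω) ∂μ = ∫ ω, X ω ∂μ + ∫ ω, Y ω ∂μ :=
  MeasureTheory.integral_add hX.integrable hY.integrable

theorem integral_mono (hX : HasMoments X μ) (hY : HasMoments Y μ) (h : ∀ ω, X ω ≤ Y ω) :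
    ∫ ω, X ω ∂μ ≤ ∫ ω, Y ω ∂μ :=
  MeasureTheory.integral_mono hX.integrable hY.integrable h

end HasMoments

theorem measurable_runMax {f : Ω → ℕ → ℝ} {T : ℕ} (hf : ∀ k < T, Measurable fun ω => f ω k) :
    Measurable fun ω => runMax (f ω) T := by
  induction T with
  | zero => exact measurable_const
  | succ T ih => exact (ih fun k hk => hf k (by omega)).max (hf T (by omega))

theorem HasMoments.runMax [IsFiniteMeasure μ] {f : Ω → ℕ → ℝ}
    (hf : ∀ k, HasMoments (fun ω => f ω k) μ) (T : ℕ) :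
    HasMoments (fun ω => AdaGradNorm.runMax (f ω) T) μ :=
  (HasMoments.sum (fun k => (hf k).abs) T).of_le (measurable_runMax fun k _ => (hf k).measurable)
    (fun _ => runMax_nonneg _ _) fun _ => runMax_le_sum_abs _ _

theorem HasMoments.maxSum [IsFiniteMeasure μ] {y : ℕ → Ω → ℝ}
    (hy : ∀ k, HasMoments (y k) μ) (T : ℕ) :
    HasMoments (fun ω => AdaGradNorm.maxSum (fun i => y i ω) T) μ :=
  HasMoments.runMax (fun k => HasMoments.sum hy (k + 1)) T

/-- Doob's `L²` maximal inequality for sums of orthogonal increments. -/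
theorem integral_maxSum_sq_le [IsFiniteMeasure μ] {y : ℕ → Ω → ℝ}
    (hy : ∀ k, HasMoments (y k) μ)
    (hsum : ∀ k, ∫ ω, (∑ i ∈ Finset.range k, y i ω) * y k ω ∂μ = 0)
    (hmax : ∀ k, ∫ ω, maxSum (fun i => y i ω) k * y k ω ∂μ = 0) (T : ℕ) :
    ∫ ω, maxSum (fun i => y i ω) T ^ 2 ∂μ ≤ 4 * ∑ k ∈ Finset.range T, ∫ ω, y k ω ^ 2 ∂μ := by
  have hM : ∀ k, HasMoments (fun ω => ∑ i ∈ Finset.range k, y i ω) μ := HasMoments.sum hy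
  have hm : ∀ k, HasMoments (fun ω => maxSum (fun i => y i ω) k) μ := HasMoments.maxSum hy
  have h1 : ∫ ω, (∑ i ∈ Finset.range T, y i ω) ^ 2 ∂μ =
      ∑ k ∈ Finset.range T, ∫ ω, y k ω ^ 2 ∂μ := by
    induction T with
    | zero => simp
    | succ T ih =>
      have : ∀ ω, (∑ i ∈ Finset.range (T + 1), y i ω) ^ 2 =
          (∑ i ∈ Finset.range T, y i ω) ^ 2 + 2 * ((∑ i ∈ Finset.range T, y i ω) * y T ω)
            + y T ω ^ 2 := fun ω => by
        rw [Finset.sum_range_succ]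
        ring
      simp only [this]
      rw [(((hM T).pow 2).add (((hM T).mul (hy T)).const_mul 2)).integral_add ((hy T).pow 2),
        ((hM T).pow 2).integral_add (((hM T).mul (hy T)).const_mul 2), integral_const_mul, hsum, ih,
        Finset.sum_range_succ]
      ring
  -- The pathwise Doob inequality with the product 2·m·M split by Young. The subtracted sum has mean
  -- zero because the running maximum before step k is uncorrelated with `y k`.
  have h2 : ∀ ω, maxSum (fun i => y i ω) T ^ 2 ≤ 4 * (∑ i ∈ Finset.range T, y i ω) ^ 2 -
      4 * ∑ k ∈ Finset.range T, maxSum (fun i => y i ω) k * y k ω := fun ω => by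
    have := runMax_sq_le (fun i => y i ω) T
    change maxSum (fun i => y i ω) T ^ 2 ≤ 2 * maxSum (fun i => y i ω) T * _ -
      2 * ∑ k ∈ Finset.range T, maxSum (fun i => y i ω) k * y k ω at this
    linarith [two_mul_le_add_sq (maxSum (fun i => y i ω) T) (2 * ∑ i ∈ Finset.range T, y i ω)]
  have hs : HasMoments (fun ω => ∑ k ∈ Finset.range T, maxSum (fun i => y i ω) k * y k ω) μ :=
    HasMoments.sum (fun k => (hm k).mul (hy k)) T
  calc ∫ ω, maxSum (fun i => y i ω) T ^ 2 ∂μ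
      ≤ ∫ ω, (4 * (∑ i ∈ Finset.range T, y i ω) ^ 2 -
          4 * ∑ k ∈ Finset.range T, maxSum (fun i => y i ω) k * y k ω) ∂μ :=
        integral_mono ((hm T).pow 2).integrable
          ((((hM T).pow 2).integrable.const_mul 4).sub (hs.integrable.const_mul 4)) h2
    _ = _ := by
      rw [integral_sub (((hM T).pow 2).integrable.const_mul 4) (hs.integrable.const_mul 4),
        integral_const_mul, integral_const_mul, h1,
        integral_finsetSum _ fun k _ => ((hm k).mul (hy k)).integrable]
      simp only [hmax, Finset.sum_const_zero]
      ring

/-- Young's inequality by cases at x = 64 v: below the threshold 16·64³ = 2²², above it 16/64 = 1/4.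
The two quarters, here and in `mul_pow_three_le`, add up to the half that is absorbed below. -/
theorem pow_three_mul_le {x v : ℝ} (hx : 0 ≤ x) (hv : 0 ≤ v) :
    16 * (x ^ 3 * v) ≤ x ^ 4 / 4 + 2 ^ 22 * v ^ 4 := by
  rcases le_total (64 * v) x with h | h
  · have : x ^ 3 * (64 * v) ≤ x ^ 3 * x := by gcongr
    have : 0 ≤ v ^ 4 := by positivity
    linarith
  · have : x ^ 3 * v ≤ (64 * v) ^ 3 * v := by gcongr
    have : 0 ≤ x ^ 4 := by positivity
    linarith

theorem mul_pow_three_le {x v : ℝ} (hx : 0 ≤ x) (hv : 0 ≤ v) :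
    16 * (v ^ 3 * x) ≤ x ^ 4 / 4 + 2 ^ 22 * v ^ 4 := by
  rcases le_total (64 * v) x with h | h
  · have h1 : v ^ 3 * x ≤ (x / 64) ^ 3 * x := by
      gcongr
      linarith
    have : 0 ≤ v ^ 4 := by positivity
    have : 0 ≤ x ^ 4 := by positivity
    linarith
  · have : v ^ 3 * x ≤ v ^ 3 * (64 * v) := by gcongr
    have : 0 ≤ x ^ 4 := by positivity
    linarith [show 0 ≤ v ^ 4 by positivity]

/-- The fourth moment of a sum of nonnegative terms is controlled by that of a sum of terms with
larger conditional expectations, up to the maximal term. -/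
theorem integral_sum_pow_four_le [IsFiniteMeasure μ] {w v : ℕ → Ω → ℝ} {s : Ω → ℝ} {T : ℕ}
    (hw : ∀ k, HasMoments (w k) μ) (hv : ∀ k, HasMoments (v k) μ) (hs : HasMoments s μ)
    (hw0 : ∀ k ω, 0 ≤ w k ω) (hv0 : ∀ k ω, 0 ≤ v k ω) (hs0 : ∀ ω, 0 ≤ s ω)
    (hws : ∀ k < T, ∀ ω, w k ω ≤ s ω)
    (hwv : ∀ k, ∫ ω, (∑ i ∈ Finset.range k, w i ω) ^ 3 * w k ω ∂μ ≤
      ∫ ω, (∑ i ∈ Finset.range k, w i ω) ^ 3 * v k ω ∂μ) :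
    ∫ ω, (∑ i ∈ Finset.range T, w i ω) ^ 4 ∂μ ≤
      2 ^ 23 * (∫ ω, (∑ i ∈ Finset.range T, v i ω) ^ 4 ∂μ + ∫ ω, s ω ^ 4 ∂μ) := by
  have hW : ∀ k, HasMoments (fun ω => ∑ i ∈ Finset.range k, w i ω) μ := HasMoments.sum hw
  have hV : ∀ k, HasMoments (fun ω => ∑ i ∈ Finset.range k, v i ω) μ := HasMoments.sum hv
  have hW0 : ∀ k ω, 0 ≤ ∑ i ∈ Finset.range k, w i ω := fun k ω =>
    Finset.sum_nonneg fun i _ => hw0 i ω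
  have hV0 : ∀ k ω, 0 ≤ ∑ i ∈ Finset.range k, v i ω := fun k ω =>
    Finset.sum_nonneg fun i _ => hv0 i ω
  have hi : ∀ j k, HasMoments (fun ω => (∑ i ∈ Finset.range j, w i ω) ^ 3 * v k ω) μ :=
    fun j k => ((hW j).pow 3).mul (hv k)
  have hi' : ∀ k, HasMoments (fun ω => (∑ i ∈ Finset.range k, w i ω) ^ 3 * w k ω) μ :=
    fun k => ((hW k).pow 3).mul (hw k)
  have hi4 : ∀ k, HasMoments (fun ω => w k ω ^ 4) μ := fun k => (hw k).pow 4
  -- Expands (x + w)⁴ ≤ x⁴ + 16x³w + 16w⁴. The weight x³ is a partial sum of earlier terms, so w may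
  -- be replaced by v under the integral; only afterwards is x enlarged to the full sum.
  have ind : ∀ j ≤ T, ∫ ω, (∑ i ∈ Finset.range j, w i ω) ^ 4 ∂μ ≤
      ∫ ω, ∑ k ∈ Finset.range j,
        (16 * ((∑ i ∈ Finset.range T, w i ω) ^ 3 * v k ω) + 16 * w k ω ^ 4) ∂μ := by
    intro j hj
    induction j with
    | zero => simp
    | succ j ih =>
      have hpt : ∀ ω, (∑ i ∈ Finset.range (j + 1), w i ω) ^ 4 ≤
          (∑ i ∈ Finset.range j, w i ω) ^ 4 +
            (16 * ((∑ i ∈ Finset.range j, w i ω) ^ 3 * w j ω) + 16 * w j ω ^ 4) := fun ω => by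
        rw [Finset.sum_range_succ]
        have hx := hW0 j ω
        have hy := hw0 j ω
        generalize ∑ i ∈ Finset.range j, w i ω = x at hx
        generalize w j ω = y at hy
        have h1 : 0 ≤ (x - y) ^ 2 * (x * y) := by positivity
        have h2 : 0 ≤ (x - y) ^ 2 * (y * y) := by positivity
        have h3 : 0 ≤ x ^ 3 * y := by positivity
        have h4 : 0 ≤ y ^ 4 := by positivity
        nlinarith
      have hcmp : ∫ ω, (∑ i ∈ Finset.range j, w i ω) ^ 3 * w j ω ∂μ ≤
          ∫ ω, (∑ i ∈ Finset.range T, w i ω) ^ 3 * v j ω ∂μ := by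
        refine (hwv j).trans ((hi j j).integral_mono (hi T j) fun ω => ?_)
        refine mul_le_mul_of_nonneg_right (pow_le_pow_left₀ (hW0 j ω) ?_ 3) (hv0 j ω)
        exact Finset.sum_le_sum_of_subset_of_nonneg (Finset.range_mono (by omega))
          fun i _ _ => hw0 i ω
      have h1 := ((hW (j + 1)).pow 4).integral_mono (((hW j).pow 4).add
        (((hi' j).const_mul 16).add ((hi4 j).const_mul 16))) hpt
      simp only [Finset.sum_range_succ (fun k => 16 * ((∑ i ∈ Finset.range T, w i _) ^ 3 * v k _)
        + 16 * w k _ ^ 4)]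
      rw [(HasMoments.sum (fun k => ((hi T k).const_mul 16).add ((hi4 k).const_mul 16))
        j).integral_add (((hi T j).const_mul 16).add ((hi4 j).const_mul 16)),
        ((hi T j).const_mul 16).integral_add ((hi4 j).const_mul 16), integral_const_mul]
      rw [((hW j).pow 4).integral_add (((hi' j).const_mul 16).add ((hi4 j).const_mul 16)),
        ((hi' j).const_mul 16).integral_add ((hi4 j).const_mul 16), integral_const_mul] at h1
      linarith [ih (by omega)]
  have hpt : ∀ ω, ∑ k ∈ Finset.range T,
      (16 * ((∑ i ∈ Finset.range T, w i ω) ^ 3 * v k ω) + 16 * w k ω ^ 4) ≤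
      1 / 2 * (∑ i ∈ Finset.range T, w i ω) ^ 4 +
        2 ^ 22 * ((∑ i ∈ Finset.range T, v i ω) ^ 4 + s ω ^ 4) := fun ω => by
    have h1 : ∑ k ∈ Finset.range T, w k ω ^ 4 ≤ s ω ^ 3 * ∑ i ∈ Finset.range T, w i ω := by
      rw [Finset.mul_sum]
      refine Finset.sum_le_sum fun k hk => ?_
      rw [pow_succ]
      exact mul_le_mul_of_nonneg_right
        (pow_le_pow_left₀ (hw0 k ω) (hws k (Finset.mem_range.1 hk) ω) 3) (hw0 k ω)
    rw [Finset.sum_add_distrib, ← Finset.mul_sum, ← Finset.mul_sum, ← Finset.mul_sum]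
    linarith [pow_three_mul_le (hW0 T ω) (hV0 T ω), mul_pow_three_le (hW0 T ω) (hs0 ω)]
  have hVs := ((hV T).pow 4).add (hs.pow 4)
  have h2 := (ind T le_rfl).trans ((HasMoments.sum (fun k => ((hi T k).const_mul 16).add
    ((hi4 k).const_mul 16)) T).integral_mono
    ((((hW T).pow 4).const_mul (1 / 2)).add (hVs.const_mul (2 ^ 22))) hpt)
  rw [(((hW T).pow 4).const_mul (1 / 2)).integral_add (hVs.const_mul (2 ^ 22)),
    integral_const_mul, integral_const_mul, ((hV T).pow 4).integral_add (hs.pow 4)] at h2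
  linarith

end Moments

/-! ### Moment estimates for random trajectories. -/

/-- Random trajectories: `Path` holds pointwise, all moments are finite, the martingale increments
are orthogonal to the past and the noise is conditionally no larger than the stochastic gradient
in mean square. -/
structure StochPath {Ω : Type*} [MeasurableSpace Ω] (μ : Measure Ω) (γ L η b₀ R : ℝ)
    (D δ a n e B y : ℕ → Ω → ℝ) : Prop where
  path : ∀ ω, Path γ L η b₀ R (fun k => D k ω) (fun k => δ k ω) (fun k => a k ω)
    (fun k => n k ω) (fun k => e k ω) (fun k => B k ω) (fun k => y k ω)
  δ_moments : ∀ k, HasMoments (δ k) μ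
  a_moments : ∀ k, HasMoments (a k) μ
  n_moments : ∀ k, HasMoments (n k) μ
  e_moments : ∀ k, HasMoments (e k) μ
  B_moments : ∀ k, HasMoments (B k) μ
  y_moments : ∀ k, HasMoments (y k) μ
  integral_sum_mul : ∀ k, ∫ ω, (∑ i ∈ Finset.range k, y i ω) * y k ω ∂μ = 0
  integral_maxSum_mul : ∀ k, ∫ ω, maxSum (fun i => y i ω) k * y k ω ∂μ = 0
  y_sq_le : ∀ k ω, y k ω ^ 2 ≤ 4 * η ^ 2 * (D k ω ^ 2 * (e k ω ^ 2 / (B k ω + n k ω ^ 2)))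
  integral_noise_le : ∀ k,
    ∫ ω, normSum (fun i => e i ω) (fun i => n i ω) (fun i => B i ω) k ^ 3 *
      (e k ω ^ 2 / (B k ω + n k ω ^ 2)) ∂μ ≤
    ∫ ω, normSum (fun i => e i ω) (fun i => n i ω) (fun i => B i ω) k ^ 3 *
      (a k ω ^ 2 / (B k ω + n k ω ^ 2)) ∂μ

theorem pow_le_one_add_pow {x : ℝ} (hx : 0 ≤ x) {p q : ℕ} (h : p ≤ q) : x ^ p ≤ 1 + x ^ q := by
  rcases le_total x 1 with h1 | h1
  · linarith [pow_le_one₀ hx h1 (n := p), pow_nonneg hx q]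
  · linarith [pow_le_pow_right₀ h1 h]

/-- Absorption step: solves the system of inequalities between the moments. -/
theorem moment_system {c₁ c₂ c₃ q₂ w₄ l₈ s₈ g₈ : ℝ} (h₁ : 0 ≤ c₁) (h₂ : 0 ≤ c₂)
    (h₃ : 0 ≤ c₃) (hs : 0 ≤ s₈) (hg : 0 ≤ g₈)
    (hq : q₂ ≤ c₁ * (1 + w₄ + l₈)) (hw : w₄ ≤ c₂ * (1 + s₈ + l₈))
    (hl : ∀ ε : ℝ, 0 < ε → l₈ ≤ c₃ * (1 + g₈ + (ε * q₂ + (40320 : ℝ) ^ 2 / ε))) :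
    q₂ ≤ (2 * c₁ * (1 + c₂) * (1 + c₃ * (1 + 40320 ^ 2 * (2 * c₁ * (1 + c₂) * (c₃ + 1) + 1))))
      * (1 + s₈ + g₈) := by
  -- ε = 1/K is small enough that the coefficient c₁(1 + c₂)c₃ε of q₂ is at most 1/2.
  set K := 2 * c₁ * (1 + c₂) * (c₃ + 1) + 1 with hK
  have hK0 : 0 < K := by positivity
  have h4 := hl (1 / K) (by positivity)
  have h5 : q₂ ≤ c₁ * (1 + c₂) * (1 + s₈ + l₈) := by
    have : c₁ * (1 + w₄ + l₈) ≤ c₁ * (1 + c₂ * (1 + s₈ + l₈) + l₈) := by gcongr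
    nlinarith [mul_nonneg h₁ hs, mul_nonneg h₁ h₂]
  set M := c₁ * (1 + c₂) with hM
  have hM0 : 0 ≤ M := by positivity
  have h6 : M * l₈ ≤ M * (c₃ * (1 + g₈ + 40320 ^ 2 * K)) + M * c₃ / K * q₂ := by
    have := mul_le_mul_of_nonneg_left h4 hM0
    refine this.trans (le_of_eq ?_)
    field_simp
    ring
  rcases le_total q₂ 0 with hq0 | hq0
  · exact hq0.trans (by positivity)
  have h7 : M * c₃ / K ≤ 1 / 2 := by
    rw [div_le_iff₀ hK0, hK]
    nlinarith [mul_nonneg hM0 h₃]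
  have h8 : M * c₃ / K * q₂ ≤ 1 / 2 * q₂ := by gcongr
  have h9 : q₂ ≤ 2 * M * (1 + s₈ + c₃ * (1 + g₈ + 40320 ^ 2 * K)) := by nlinarith
  have h10 : 1 + s₈ + c₃ * (1 + g₈ + 40320 ^ 2 * K) ≤
      (1 + c₃ * (1 + 40320 ^ 2 * K)) * (1 + s₈ + g₈) := by
    have e1 : 0 ≤ c₃ * s₈ := by positivity
    have e2 : 0 ≤ c₃ * (40320 ^ 2 * K) * (s₈ + g₈) := by positivity
    linarith
  calc q₂ ≤ 2 * M * (1 + s₈ + c₃ * (1 + g₈ + 40320 ^ 2 * K)) := h9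
    _ ≤ 2 * M * ((1 + c₃ * (1 + 40320 ^ 2 * K)) * (1 + s₈ + g₈)) := by gcongr
    _ = _ := by
      rw [hM]
      ring

/-- The exponential series gives (log Q)⁸ ≤ 8! Q with 8! = 40320, and Young's inequality does the
rest; 20160 is 8!/2, from completing the square. -/
theorem log_pow_eight_le {Q ε : ℝ} (hQ : 1 ≤ Q) (hε : 0 < ε) :
    Real.log Q ^ 8 ≤ ε * Q ^ 2 + (40320 : ℝ) ^ 2 / ε := by
  have h1 := Real.pow_div_factorial_le_exp _ (Real.log_nonneg hQ) 8
  rw [Real.exp_log (by linarith), div_le_iff₀ (by positivity)] at h1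
  have h2 : ((Nat.factorial 8 : ℕ) : ℝ) = 40320 := by norm_num [Nat.factorial]
  rw [h2] at h1
  have h3 : ε * Q ^ 2 + (40320 : ℝ) ^ 2 / ε - Q * 40320 =
      ε * (Q - 20160 / ε) ^ 2 + (40320 ^ 2 - 20160 ^ 2) / ε := by
    field_simp
    ring
  have h4 : 0 ≤ ε * (Q - 20160 / ε) ^ 2 + (40320 ^ 2 - 20160 ^ 2) / ε := by positivity
  linarith

theorem add_three_pow_eight_le {x y : ℝ} (hx : 0 ≤ x) (hy : 0 ≤ y) :
    (1 + x + y) ^ 8 ≤ 2 ^ 14 * (1 + x ^ 8 + y ^ 8) := by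
  have h1 := add_pow_le (add_nonneg zero_le_one hx) hy 8
  have h2 := add_pow_le zero_le_one hx 8
  have : 0 ≤ y ^ 8 := by positivity
  norm_num at h1 h2
  linarith

namespace StochPath

variable {Ω : Type*} [MeasurableSpace Ω] {μ : Measure Ω} {γ L η b₀ R : ℝ}
  {D δ a n e B y : ℕ → Ω → ℝ}

theorem moments_div (h : StochPath μ γ L η b₀ R D δ a n e B y) [IsFiniteMeasure μ] (hb : 0 < b₀)
    {f : ℕ → Ω → ℝ} (hf : ∀ k, HasMoments (f k) μ) (k : ℕ) :
    HasMoments (fun ω => f k ω ^ 2 / (B k ω + n k ω ^ 2)) μ := by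
  have hB := (h.B_moments k).measurable
  have hn := (h.n_moments k).measurable
  have hfm := (hf k).measurable
  have hpos : ∀ ω, b₀ ^ 2 ≤ B k ω + n k ω ^ 2 := fun ω => by
    have h1 := (h.path ω).B_mono (Nat.zero_le k)
    simp only [(h.path ω).B_zero] at h1
    linarith [sq_nonneg (n k ω)]
  have hb2 : 0 < b₀ ^ 2 := by positivity
  refine (((hf k).pow 2).const_mul (1 / b₀ ^ 2)).of_le (by fun_prop)
    (fun ω => div_nonneg (sq_nonneg _) (hb2.le.trans (hpos ω))) fun ω => ?_
  rw [one_div, inv_mul_eq_div]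
  gcongr
  exact hpos ω

theorem moments_normSum (h : StochPath μ γ L η b₀ R D δ a n e B y) [IsFiniteMeasure μ]
    (hb : 0 < b₀) {f : ℕ → Ω → ℝ} (hf : ∀ k, HasMoments (f k) μ) (T : ℕ) :
    HasMoments (fun ω => normSum (fun i => f i ω) (fun i => n i ω) (fun i => B i ω) T) μ :=
  HasMoments.sum (h.moments_div hb hf) T

theorem moments_log (h : StochPath μ γ L η b₀ R D δ a n e B y) [IsFiniteMeasure μ] (hb : 0 < b₀)
    (T : ℕ) : HasMoments (fun ω => Real.log (B T ω / B 0 ω)) μ := by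
  have hB := (h.B_moments T).measurable
  have hB0 := (h.B_moments 0).measurable
  refine ((h.B_moments T).const_mul (1 / b₀ ^ 2)).of_le (by fun_prop)
    (fun ω => (h.path ω).log_nonneg hb T) fun ω => ?_
  have h1 := (h.path ω).B_pos hb T
  have h2 := (h.path ω).B_zero
  have h3 := (h.path ω).B_zero_pos hb
  refine (Real.log_le_self (by positivity)).trans (le_of_eq ?_)
  rw [h2]
  ring

theorem moments_envelope (h : StochPath μ γ L η b₀ R D δ a n e B y) [IsFiniteMeasure μ]
    (hb : 0 < b₀) (T : ℕ) :
    HasMoments (fun ω => envelope (fun k => e k ω) (fun k => n k ω) (fun k => B k ω)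
      (fun k => y k ω) T) μ :=
  (((HasMoments.const 1).add (HasMoments.maxSum h.y_moments T)).add
    ((h.moments_normSum hb h.e_moments T).pow 2)).add ((h.moments_log hb T).pow 2)

theorem moments_sum_sq (h : StochPath μ γ L η b₀ R D δ a n e B y) [IsFiniteMeasure μ] (T : ℕ) :
    HasMoments (fun ω => ∑ k ∈ Finset.range T, e k ω ^ 2) μ :=
  HasMoments.sum (fun k => (h.e_moments k).pow 2) T

theorem moments_log_sum_sq (h : StochPath μ γ L η b₀ R D δ a n e B y) [IsFiniteMeasure μ]
    (T : ℕ) : HasMoments (fun ω => Real.log (1 + ∑ k ∈ Finset.range T, e k ω ^ 2)) μ := by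
  have hm := (h.moments_sum_sq T).measurable
  have h0 : ∀ ω, 0 ≤ ∑ k ∈ Finset.range T, e k ω ^ 2 := fun ω =>
    Finset.sum_nonneg fun _ _ => sq_nonneg _
  refine ((HasMoments.const 1).add (h.moments_sum_sq T)).of_le (by fun_prop)
    (fun ω => Real.log_nonneg (by linarith [h0 ω]))
    (fun ω => Real.log_le_self (by linarith [h0 ω]))

/-- Trades the noise for the stochastic gradient, whose normalized sum is at most 2(1 + s/b₀²) l
pathwise. The product of fourth powers is split by Young into s⁸ and l⁸, the origin of the eighth
powers. -/
theorem integral_normSum_pow_four_le (h : StochPath μ γ L η b₀ R D δ a n e B y)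
    [IsProbabilityMeasure μ] (hb : 0 < b₀) (T : ℕ) :
    ∫ ω, normSum (fun k => e k ω) (fun k => n k ω) (fun k => B k ω) T ^ 4 ∂μ ≤
      2 ^ 34 * (1 + 1 / b₀ ^ 2) ^ 8 * (1 + ∫ ω, runMax (fun k => e k ω ^ 2) T ^ 8 ∂μ +
        ∫ ω, Real.log (B T ω / B 0 ω) ^ 8 ∂μ) := by
  have hS : HasMoments (fun ω => runMax (fun k => e k ω ^ 2) T) μ :=
    HasMoments.runMax (fun k => (h.e_moments k).pow 2) T
  have hS0 : ∀ ω, 0 ≤ runMax (fun k => e k ω ^ 2) T := fun ω => runMax_nonneg _ _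
  have hl := h.moments_log hb T
  have hl0 : ∀ ω, 0 ≤ Real.log (B T ω / B 0 ω) := fun ω => (h.path ω).log_nonneg hb T
  have hden : ∀ k ω, 0 ≤ B k ω + n k ω ^ 2 := fun k ω =>
    add_nonneg ((h.path ω).B_pos hb k).le (sq_nonneg _)
  have hV := h.moments_normSum hb h.a_moments T
  have h1 := integral_sum_pow_four_le (h.moments_div hb h.e_moments)
    (h.moments_div hb h.a_moments) (hS.const_mul (1 / b₀ ^ 2)) (T := T)
    (fun k ω => div_nonneg (sq_nonneg _) (hden k ω))
    (fun k ω => div_nonneg (sq_nonneg _) (hden k ω))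
    (fun ω => mul_nonneg (by positivity) (hS0 ω))
    (fun k hk ω => ((h.path ω).div_le_runMax hb hk).trans (le_of_eq (by ring)))
    h.integral_noise_le
  refine LE.le.trans h1 ?_
  change 2 ^ 23 * (∫ ω, normSum (fun k => a k ω) (fun k => n k ω) (fun k => B k ω) T ^ 4 ∂μ +
    ∫ ω, (1 / b₀ ^ 2 * runMax (fun k => e k ω ^ 2) T) ^ 4 ∂μ) ≤ _
  rw [← (hV.pow 4).integral_add ((hS.const_mul (1 / b₀ ^ 2)).pow 4)]
  have h2 : 1 + ∫ ω, runMax (fun k => e k ω ^ 2) T ^ 8 ∂μ + ∫ ω, Real.log (B T ω / B 0 ω) ^ 8 ∂μ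
      = ∫ ω, (1 + runMax (fun k => e k ω ^ 2) T ^ 8 + Real.log (B T ω / B 0 ω) ^ 8) ∂μ := by
    rw [((HasMoments.const 1).add (hS.pow 8)).integral_add (hl.pow 8),
      (HasMoments.const 1).integral_add (hS.pow 8)]
    simp
  rw [h2, show (2 : ℝ) ^ 34 * (1 + 1 / b₀ ^ 2) ^ 8 = 2 ^ 23 * (2 ^ 11 * (1 + 1 / b₀ ^ 2) ^ 8) by
    ring, mul_assoc (2 ^ 23), ← integral_const_mul (2 ^ 11 * (1 + 1 / b₀ ^ 2) ^ 8)]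
  refine mul_le_mul_of_nonneg_left ?_ (by positivity : (0 : ℝ) ≤ 2 ^ 23)
  refine ((hV.pow 4).add ((hS.const_mul (1 / b₀ ^ 2)).pow 4)).integral_mono
    ((((HasMoments.const 1).add (hS.pow 8)).add (hl.pow 8)).const_mul _) fun ω => ?_
  have h3 := (h.path ω).normSum_le hb T
  have h3' := (h.path ω).normSum_nonneg hb (fun k => a k ω) T
  have hs0 := hS0 ω
  have hlω := hl0 ω
  generalize Real.log (B T ω / B 0 ω) = l at *
  generalize runMax (fun k => e k ω ^ 2) T = s at *
  generalize normSum (fun k => a k ω) (fun k => n k ω) (fun k => B k ω) T = V at *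
  have hβ : 0 ≤ 1 / b₀ ^ 2 := by positivity
  rw [div_eq_mul_one_div] at h3
  generalize 1 / b₀ ^ 2 = β at *
  have h4 : V ^ 4 ≤ (2 * (1 + s * β) * l) ^ 4 := pow_le_pow_left₀ h3' h3 4
  have h5 : (1 + s * β) ^ 8 ≤ (1 + β) ^ 8 * (1 + s) ^ 8 := by
    rw [← mul_pow]
    gcongr
    nlinarith
  have h6 : (1 + s) ^ 8 ≤ 2 ^ 7 * (1 + s ^ 8) := by
    simpa using add_pow_le zero_le_one hs0 8
  have h7 : (2 * (1 + s * β) * l) ^ 4 ≤ 8 * ((1 + s * β) ^ 8 + l ^ 8) := by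
    have := sq_nonneg ((1 + s * β) ^ 4 - l ^ 4)
    calc (2 * (1 + s * β) * l) ^ 4 = 8 * (2 * (1 + s * β) ^ 4 * l ^ 4) := by ring
      _ ≤ 8 * (((1 + s * β) ^ 4) ^ 2 + (l ^ 4) ^ 2) := by
        gcongr
        exact two_mul_le_add_sq _ _
      _ = _ := by ring
  have h8 : (β * s) ^ 4 ≤ (1 + β) ^ 8 * (1 + s ^ 8) := by
    rw [mul_pow]
    gcongr
    · exact (pow_le_pow_left₀ hβ (by linarith) 4).trans
        (pow_le_pow_right₀ (by linarith) (by norm_num))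
    · exact pow_le_one_add_pow hs0 (by norm_num)
  have h9 : 1 ≤ (1 + β) ^ 8 := one_le_pow₀ (by linarith)
  have h10 : l ^ 8 ≤ (1 + β) ^ 8 * l ^ 8 := le_mul_of_one_le_left (by positivity) h9
  have h11 : (1 + β) ^ 8 * (1 + s) ^ 8 ≤ (1 + β) ^ 8 * (2 ^ 7 * (1 + s ^ 8)) := by gcongr
  have h12 : 0 ≤ (1 + β) ^ 8 * (1 + s ^ 8) := by positivity
  have h13 : 0 ≤ (1 + β) ^ 8 * l ^ 8 := by positivity
  linarith

end StochPath

/-- The term A m W is split so that m² carries the coefficient 1/2, which leaves room to absorb the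
second moment of m. The powers of W and l that arise are at most 4 and 8. -/
theorem envelope_mul_le {A m W l : ℝ} (hA : 0 ≤ A) (hW : 0 ≤ W) (hl : 0 ≤ l) :
    A * ((1 + m + W ^ 2 + l ^ 2) * W) ≤
      1 / 2 * m ^ 2 + (3 * A + A ^ 2 / 2) * (1 + W ^ 4 + l ^ 8) := by
  have h1 : A * W ^ 1 ≤ A * (1 + W ^ 4) := by
    gcongr
    exact pow_le_one_add_pow hW (by norm_num)
  have h2 : A * W ^ 3 ≤ A * (1 + W ^ 4) := by
    gcongr
    exact pow_le_one_add_pow hW (by norm_num)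
  have h3 : A ^ 2 * W ^ 2 ≤ A ^ 2 * (1 + W ^ 4) := by
    gcongr
    exact pow_le_one_add_pow hW (by norm_num)
  have h4 : A * W ^ 2 ≤ A * (1 + W ^ 4) := by
    gcongr
    exact pow_le_one_add_pow hW (by norm_num)
  have h5 : A * l ^ 4 ≤ A * (1 + l ^ 8) := by
    gcongr
    exact pow_le_one_add_pow hl (by norm_num)
  have h6 : A * (2 * l ^ 2 * W) ≤ A * ((l ^ 2) ^ 2 + W ^ 2) := by
    gcongr
    exact two_mul_le_add_sq _ _
  have h7 : 0 ≤ A * l ^ 8 := by positivity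
  have h8 : 0 ≤ A ^ 2 * l ^ 8 := by positivity
  have h9 : 0 ≤ A * W ^ 4 := by positivity
  linarith [two_mul_le_add_sq m (A * W)]

theorem envelope_sq_le {m W l : ℝ} (hl : 0 ≤ l) :
    (1 + m + W ^ 2 + l ^ 2) ^ 2 ≤ 4 * m ^ 2 + 8 * (1 + W ^ 4 + l ^ 8) := by
  have h1 : l ^ 4 ≤ 1 + l ^ 8 := pow_le_one_add_pow hl (by norm_num)
  have h2 : 0 ≤ W ^ 4 := by positivity
  have h3 : 0 ≤ l ^ 8 := by positivity
  have h4 : (1 + m + W ^ 2 + l ^ 2) ^ 2 ≤ 4 * (1 + m ^ 2 + W ^ 4 + l ^ 4) := by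
    linarith [sq_nonneg (1 - m), sq_nonneg (1 - W ^ 2), sq_nonneg (1 - l ^ 2),
      sq_nonneg (m - W ^ 2), sq_nonneg (m - l ^ 2), sq_nonneg (W ^ 2 - l ^ 2)]
  linarith

/-- The second moment of the envelope is controlled by moments of the noise alone. -/
theorem exists_integral_envelope_sq_le {γ L η b₀ R : ℝ} (hγ : 0 < γ) (hL : 0 < L)
    (hη : 0 < η) (hb : 0 < b₀) : ∃ C : ℝ, 0 ≤ C ∧
      ∀ {Ω : Type u} [MeasurableSpace Ω] (μ : Measure Ω) [IsProbabilityMeasure μ]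
        (D δ a n e B y : ℕ → Ω → ℝ), StochPath μ γ L η b₀ R D δ a n e B y → ∀ T : ℕ,
        ∫ ω, envelope (fun k => e k ω) (fun k => n k ω) (fun k => B k ω)
          (fun k => y k ω) T ^ 2 ∂μ ≤
          C * (1 + ∫ ω, runMax (fun k => e k ω ^ 2) T ^ 8 ∂μ +
            ∫ ω, Real.log (1 + ∑ k ∈ Finset.range T, e k ω ^ 2) ^ 8 ∂μ) := by
  obtain ⟨C, hC1, hC⟩ := exists_path_bound (R := R) hγ hL hη hb
  set A := 16 * η ^ 2 * C with hA
  have hA0 : 0 ≤ A := by positivity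
  set c₁ := 8 + 4 * (6 * A + A ^ 2) with hc₁
  set c₂ : ℝ := 2 ^ 34 * (1 + 1 / b₀ ^ 2) ^ 8 with hc₂
  set c₃ : ℝ := C ^ 8 * 2 ^ 14 with hc₃
  have h₁ : 0 ≤ c₁ := by positivity
  have h₂ : 0 ≤ c₂ := by positivity
  have h₃ : 0 ≤ c₃ := by positivity
  -- The constant is the one in the conclusion of `moment_system`, filled in by unification.
  refine ⟨_, ?_, fun μ _ D δ a n e B y h T => moment_system h₁ h₂ h₃
    (integral_nonneg fun ω => pow_nonneg (runMax_nonneg _ _) 8)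
    (integral_nonneg fun ω => by positivity) ?_ (h.integral_normSum_pow_four_le hb T) ?_⟩
  · positivity
  · have hm := HasMoments.maxSum h.y_moments T
    have hW := h.moments_normSum hb h.e_moments T
    have hl := h.moments_log hb T
    have hQ := h.moments_envelope hb T
    have hW0 := fun ω => (h.path ω).normSum_nonneg hb (fun k => e k ω) T
    have hl0 := fun ω => (h.path ω).log_nonneg hb T
    have hR := (((HasMoments.const (μ := μ) 1).add (hW.pow 4)).add (hl.pow 8))
    have hRint : ∫ ω, (1 + normSum (fun k => e k ω) (fun k => n k ω) (fun k => B k ω) T ^ 4 +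
        Real.log (B T ω / B 0 ω) ^ 8) ∂μ =
        1 + ∫ ω, normSum (fun k => e k ω) (fun k => n k ω) (fun k => B k ω) T ^ 4 ∂μ +
        ∫ ω, Real.log (B T ω / B 0 ω) ^ 8 ∂μ := by
      rw [((HasMoments.const 1).add (hW.pow 4)).integral_add (hl.pow 8),
        (HasMoments.const 1).integral_add (hW.pow 4)]
      simp
    rw [← hRint]
    have hm2 := integral_maxSum_sq_le h.y_moments h.integral_sum_mul h.integral_maxSum_mul T
    rw [← integral_finsetSum _ fun k _ => ((h.y_moments k).pow 2).integrable,
      ← integral_const_mul] at hm2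
    -- D_k² is bounded by the envelope at the final time T, so the envelope factors out of the sum
    -- and leaves A Q W.
    have hpt : ∀ ω, 4 * ∑ k ∈ Finset.range T, y k ω ^ 2 ≤
        1 / 2 * maxSum (fun k => y k ω) T ^ 2 + (3 * A + A ^ 2 / 2) *
        (1 + normSum (fun k => e k ω) (fun k => n k ω) (fun k => B k ω) T ^ 4 +
        Real.log (B T ω / B 0 ω) ^ 8) := fun ω => by
      refine le_trans ?_ (envelope_mul_le (m := maxSum (fun k => y k ω) T) hA0 (hW0 ω) (hl0 ω))
      change _ ≤ A * (envelope (fun k => e k ω) (fun k => n k ω) (fun k => B k ω)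
          (fun k => y k ω) T * _)
      rw [hA, normSum, Finset.mul_sum, Finset.mul_sum, Finset.mul_sum]
      refine Finset.sum_le_sum fun k hk => ?_
      have h1 := (hC _ _ _ _ _ _ _ (h.path ω) T).1 k (Finset.mem_range.1 hk).le
      have h2 : 0 ≤ e k ω ^ 2 / (B k ω + n k ω ^ 2) :=
        div_nonneg (sq_nonneg _) (add_nonneg ((h.path ω).B_pos hb k).le (sq_nonneg _))
      calc 4 * y k ω ^ 2
          ≤ 4 * (4 * η ^ 2 * (D k ω ^ 2 * (e k ω ^ 2 / (B k ω + n k ω ^ 2)))) := by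
            gcongr
            exact h.y_sq_le k ω
        _ ≤ 4 * (4 * η ^ 2 * ((C * envelope (fun k => e k ω) (fun k => n k ω) (fun k => B k ω)
          (fun k => y k ω) T) * (e k ω ^ 2 / (B k ω + n k ω ^ 2)))) := by gcongr
        _ = _ := by ring
    have hm3 := (((HasMoments.sum (fun k => (h.y_moments k).pow 2) T).const_mul 4).integral_mono
      (((hm.pow 2).const_mul (1 / 2)).add (hR.const_mul (3 * A + A ^ 2 / 2))) hpt)
    rw [((hm.pow 2).const_mul (1 / 2)).integral_add (hR.const_mul (3 * A + A ^ 2 / 2)),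
      integral_const_mul (1 / 2 : ℝ), integral_const_mul (3 * A + A ^ 2 / 2)] at hm3
    have hq := (hQ.pow 2).integral_mono (((hm.pow 2).const_mul 4).add (hR.const_mul 8))
      fun ω => envelope_sq_le (hl0 ω)
    rw [((hm.pow 2).const_mul 4).integral_add (hR.const_mul 8), integral_const_mul (4 : ℝ),
      integral_const_mul (8 : ℝ)] at hq
    rw [hc₁]
    linarith
  · intro ε hε
    have hl := h.moments_log hb T
    have hQ := h.moments_envelope hb T
    have hg := h.moments_log_sum_sq T
    have hpt : ∀ ω, Real.log (B T ω / B 0 ω) ^ 8 ≤ c₃ * (1 +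
        Real.log (1 + ∑ k ∈ Finset.range T, e k ω ^ 2) ^ 8 +
        (ε * envelope (fun k => e k ω) (fun k => n k ω) (fun k => B k ω)
          (fun k => y k ω) T ^ 2 + (40320 : ℝ) ^ 2 / ε)) := fun ω => by
      have h1 := (hC _ _ _ _ _ _ _ (h.path ω) T).2.2
      have h2 := one_le_envelope (fun k => e k ω) (fun k => n k ω) (fun k => B k ω)
          (fun k => y k ω) T
      have h3 : 0 ≤ Real.log (1 + ∑ k ∈ Finset.range T, e k ω ^ 2) := Real.log_nonneg
        (le_add_of_nonneg_right (Finset.sum_nonneg fun _ _ => sq_nonneg _))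
      refine (pow_le_pow_left₀ ((h.path ω).log_nonneg hb T) h1 8).trans ?_
      rw [mul_pow, hc₃, mul_assoc]
      gcongr
      refine (add_three_pow_eight_le h3 (Real.log_nonneg h2)).trans ?_
      gcongr
      exact log_pow_eight_le h2 hε
    have hR1 := (HasMoments.const (μ := μ) 1).add (hg.pow 8)
    have hR2 := ((hQ.pow 2).const_mul ε).add (HasMoments.const (μ := μ) ((40320 : ℝ) ^ 2 / ε))
    refine ((hl.pow 8).integral_mono ((hR1.add hR2).const_mul c₃) hpt).trans (le_of_eq ?_)
    rw [integral_const_mul, hR1.integral_add hR2, (HasMoments.const 1).integral_add (hg.pow 8),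
      ((hQ.pow 2).const_mul ε).integral_add (HasMoments.const _), integral_const_mul]
    simp

/-- The accumulated gap in terms of moments of the noise. -/
theorem exists_integral_sum_gap_le {γ L η b₀ R : ℝ} (hγ : 0 < γ) (hL : 0 < L)
    (hη : 0 < η) (hb : 0 < b₀) : ∃ C : ℝ, 0 ≤ C ∧
      ∀ {Ω : Type u} [MeasurableSpace Ω] (μ : Measure Ω) [IsProbabilityMeasure μ]
        (D δ a n e B y : ℕ → Ω → ℝ), StochPath μ γ L η b₀ R D δ a n e B y → ∀ (T : ℕ) (ρ : ℝ),
        0 ≤ ρ → ∫ ω, ∑ k ∈ Finset.range T, e k ω ^ 2 ∂μ ≤ ρ ^ 2 →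
        ∫ ω, ∑ k ∈ Finset.range T, δ k ω ∂μ ≤
          C * (1 + ∫ ω, runMax (fun k => e k ω ^ 2) T ^ 8 ∂μ +
            ∫ ω, Real.log (1 + ∑ k ∈ Finset.range T, e k ω ^ 2) ^ 8 ∂μ) * (1 + ρ) := by
  obtain ⟨C, hC1, hC⟩ := exists_path_bound (R := R) hγ hL hη hb
  obtain ⟨K, hK0, hK⟩ := exists_integral_envelope_sq_le (R := R) hγ hL hη hb
  refine ⟨C * (K + 1), by positivity, fun μ _ D δ a n e B y h T ρ hρ hΞ => ?_⟩
  have hQ := h.moments_envelope hb T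
  have hΞm := h.moments_sum_sq T
  have hΞ0 : ∀ ω, 0 ≤ ∑ k ∈ Finset.range T, e k ω ^ 2 := fun ω =>
    Finset.sum_nonneg fun _ _ => sq_nonneg _
  have hs8 : 0 ≤ ∫ ω, runMax (fun k => e k ω ^ 2) T ^ 8 ∂μ :=
    integral_nonneg fun ω => pow_nonneg (runMax_nonneg _ _) 8
  have hg8 : 0 ≤ ∫ ω, Real.log (1 + ∑ k ∈ Finset.range T, e k ω ^ 2) ^ 8 ∂μ :=
    integral_nonneg fun ω => by positivity
  have hq := hK μ D δ a n e B y h T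
  set G := 1 + ∫ ω, runMax (fun k => e k ω ^ 2) T ^ 8 ∂μ +
            ∫ ω, Real.log (1 + ∑ k ∈ Finset.range T, e k ω ^ 2) ^ 8 ∂μ with hG
  have hG1 : 1 ≤ G := by linarith
  have hsqrt : HasMoments (fun ω => √(∑ k ∈ Finset.range T, e k ω ^ 2)) μ := by
    refine ((HasMoments.const 1).add hΞm).of_le hΞm.measurable.sqrt
      (fun ω => Real.sqrt_nonneg _) fun ω => ?_
    nlinarith [Real.sq_sqrt (hΞ0 ω), sq_nonneg (√(∑ k ∈ Finset.range T, e k ω ^ 2) - 1)]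
  have hX := (HasMoments.sum h.δ_moments T).integral_mono
    (((hQ.pow 2).add (hQ.mul hsqrt)).const_mul C)
    (fun ω => (hC _ _ _ _ _ _ _ (h.path ω) T).2.1)
  rw [integral_const_mul, (hQ.pow 2).integral_add (hQ.mul hsqrt)] at hX
  have hcross : ∫ ω, envelope (fun k => e k ω) (fun k => n k ω) (fun k => B k ω)
      (fun k => y k ω) T * √(∑ k ∈ Finset.range T, e k ω ^ 2) ∂μ ≤ (K + 1) * G * ρ := by
    -- Young with weight ρ balances E Q² against E Ξ ≤ ρ². For ρ = 0 the weight is unavailable, but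
    -- then Ξ vanishes almost surely.
    rcases hρ.eq_or_lt with rfl | hρ
    · have hz : (fun ω => ∑ k ∈ Finset.range T, e k ω ^ 2) =ᵐ[μ] 0 :=
        (integral_eq_zero_iff_of_nonneg hΞ0 hΞm.integrable).1
          (le_antisymm (by simpa using hΞ) (integral_nonneg hΞ0))
      rw [mul_zero]
      refine (integral_eq_zero_of_ae ?_).le
      filter_upwards [hz] with ω hω
      simp only [Pi.zero_apply] at hω ⊢
      rw [hω, Real.sqrt_zero, mul_zero]
    · have hpt : ∀ ω, envelope (fun k => e k ω) (fun k => n k ω) (fun k => B k ω)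
          (fun k => y k ω) T * √(∑ k ∈ Finset.range T, e k ω ^ 2) ≤
          ρ / 2 * envelope (fun k => e k ω) (fun k => n k ω) (fun k => B k ω)
          (fun k => y k ω) T ^ 2 + 1 / (2 * ρ) * ∑ k ∈ Finset.range T, e k ω ^ 2 := fun ω => by
        have h1 := Real.sq_sqrt (hΞ0 ω)
        generalize √(∑ k ∈ Finset.range T, e k ω ^ 2) = r at *
        rw [← h1]
        generalize envelope (fun k => e k ω) (fun k => n k ω) (fun k => B k ω)
          (fun k => y k ω) T = Q
        have h2 : ρ / 2 * Q ^ 2 + 1 / (2 * ρ) * r ^ 2 - Q * r = 1 / (2 * ρ) * (ρ * Q - r) ^ 2 := by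
          field_simp
          ring
        have h3 : 0 ≤ 1 / (2 * ρ) * (ρ * Q - r) ^ 2 := by positivity
        linarith
      have h1 := (hQ.mul hsqrt).integral_mono (((hQ.pow 2).const_mul (ρ / 2)).add
        (hΞm.const_mul (1 / (2 * ρ)))) hpt
      rw [((hQ.pow 2).const_mul (ρ / 2)).integral_add (hΞm.const_mul (1 / (2 * ρ))),
        integral_const_mul, integral_const_mul] at h1
      refine h1.trans ?_
      calc _ ≤ ρ / 2 * (K * G) + 1 / (2 * ρ) * ρ ^ 2 := by gcongr
        _ = ρ / 2 * (K * G + 1) := by field_simp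
        _ ≤ ρ / 2 * (2 * ((K + 1) * G)) := by
          gcongr
          nlinarith [mul_nonneg hK0 (zero_le_one.trans hG1)]
        _ = _ := by ring
  refine hX.trans ?_
  have h2 : C * (∫ ω, envelope (fun k => e k ω) (fun k => n k ω) (fun k => B k ω)
      (fun k => y k ω) T ^ 2 ∂μ + ∫ ω, envelope (fun k => e k ω) (fun k => n k ω)
      (fun k => B k ω) (fun k => y k ω) T * √(∑ k ∈ Finset.range T, e k ω ^ 2) ∂μ) ≤
      C * ((K + 1) * G + (K + 1) * G * ρ) := by
    gcongr
    linarith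
  linarith

/-! ### The algorithm as a function of the seeds; index k stands for the iterate x_{k+1}. -/

section Trajectory

variable {d : ℕ} {S : Type*}

/-- The gradient of `F` at the `k`-th state. -/
noncomputable def gradAt (F : EuclideanSpace ℝ (Fin d) → ℝ)
    (g : EuclideanSpace ℝ (Fin d) → S → EuclideanSpace ℝ (Fin d)) (η b₀ : ℝ)
    (x₁ : EuclideanSpace ℝ (Fin d)) (k : ℕ) (s : ℕ → S) : EuclideanSpace ℝ (Fin d) :=
  gradient F (state g η b₀ x₁ s k).1

/-- The stochastic gradient at the `k`-th state. -/
noncomputable def oracleAt (g : EuclideanSpace ℝ (Fin d) → S → EuclideanSpace ℝ (Fin d))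
    (η b₀ : ℝ) (x₁ : EuclideanSpace ℝ (Fin d)) (k : ℕ) (s : ℕ → S) : EuclideanSpace ℝ (Fin d) :=
  g (state g η b₀ x₁ s k).1 (s (k + 1))

/-- The noise of the stochastic gradient at the `k`-th state. -/
noncomputable def noiseAt (F : EuclideanSpace ℝ (Fin d) → ℝ)
    (g : EuclideanSpace ℝ (Fin d) → S → EuclideanSpace ℝ (Fin d)) (η b₀ : ℝ)
    (x₁ : EuclideanSpace ℝ (Fin d)) (k : ℕ) (s : ℕ → S) : EuclideanSpace ℝ (Fin d) :=
  oracleAt g η b₀ x₁ k s - gradAt F g η b₀ x₁ k s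

/-- The factor of the noise in the `k`-th martingale increment. -/
noncomputable def weightAt (F : EuclideanSpace ℝ (Fin d) → ℝ)
    (g : EuclideanSpace ℝ (Fin d) → S → EuclideanSpace ℝ (Fin d)) (η b₀ : ℝ)
    (x₁ : EuclideanSpace ℝ (Fin d)) (k : ℕ) (s : ℕ → S) : ℝ :=
  -(2 * η / √((state g η b₀ x₁ s k).2 + ‖gradAt F g η b₀ x₁ k s‖ ^ 2))

/-- The `k`-th martingale increment. -/
noncomputable def incrementAt (F : EuclideanSpace ℝ (Fin d) → ℝ)
    (g : EuclideanSpace ℝ (Fin d) → S → EuclideanSpace ℝ (Fin d)) (η b₀ : ℝ)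
    (x₁ xstar : EuclideanSpace ℝ (Fin d)) (k : ℕ) (s : ℕ → S) : ℝ :=
  weightAt F g η b₀ x₁ k s *
    inner ℝ (noiseAt F g η b₀ x₁ k s) ((state g η b₀ x₁ s k).1 - xstar)

variable {F : EuclideanSpace ℝ (Fin d) → ℝ}
  {g : EuclideanSpace ℝ (Fin d) → S → EuclideanSpace ℝ (Fin d)} {γ L η b₀ R : ℝ}
  {x₁ xstar : EuclideanSpace ℝ (Fin d)}

theorem state_succ_snd (k : ℕ) (s : ℕ → S) : (state g η b₀ x₁ s (k + 1)).2 =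
    (state g η b₀ x₁ s k).2 + ‖oracleAt g η b₀ x₁ k s‖ ^ 2 := rfl

theorem state_succ_fst (k : ℕ) (s : ℕ → S) : (state g η b₀ x₁ s (k + 1)).1 =
    (state g η b₀ x₁ s k).1 - (η / √(state g η b₀ x₁ s (k + 1)).2) •
      oracleAt g η b₀ x₁ k s := rfl

theorem sq_le_state_snd (k : ℕ) (s : ℕ → S) : b₀ ^ 2 ≤ (state g η b₀ x₁ s k).2 := by
  rw [state_snd]
  exact le_add_of_nonneg_right (Finset.sum_nonneg fun _ _ => sq_nonneg _)

/-- Since b_t dominates the current stochastic gradient, no step is longer than η. The growth in k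
does not enter the rate: the bound only serves to make all moments finite. -/
theorem norm_state_sub_le (hη : 0 < η) (hb : 0 < b₀) (hx : ‖x₁ - xstar‖ ≤ R) (k : ℕ)
    (s : ℕ → S) : ‖(state g η b₀ x₁ s k).1 - xstar‖ ≤ R + η * k := by
  induction k with
  | zero => simpa [state] using hx
  | succ k ih =>
    have hB : 0 < (state g η b₀ x₁ s (k + 1)).2 :=
      lt_of_lt_of_le (by positivity) (sq_le_state_snd (k + 1) s)
    have h1 : ‖oracleAt g η b₀ x₁ k s‖ ≤ √(state g η b₀ x₁ s (k + 1)).2 := by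
      refine Real.le_sqrt_of_sq_le ?_
      rw [state_succ_snd]
      linarith [sq_le_state_snd (g := g) (η := η) (b₀ := b₀) (x₁ := x₁) k s, sq_nonneg b₀]
    have h2 : ‖(η / √(state g η b₀ x₁ s (k + 1)).2) • oracleAt g η b₀ x₁ k s‖ ≤ η := by
      rw [norm_smul, Real.norm_eq_abs, abs_of_nonneg (by positivity), div_mul_eq_mul_div,
        div_le_iff₀ (Real.sqrt_pos.2 hB)]
      gcongr
    rw [state_succ_fst, sub_right_comm]
    refine (norm_sub_le _ _).trans ?_
    push_cast
    linarith

theorem path_of_seeds (hη : 0 < η) (hb : 0 < b₀) (hq : IsQuasarConvex γ F xstar)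
    (hF : IsSmoothWith L F) (hx : ‖x₁ - xstar‖ ≤ R) (s : ℕ → S) :
    Path γ L η b₀ R (fun k => ‖(state g η b₀ x₁ s k).1 - xstar‖)
      (fun k => F (state g η b₀ x₁ s k).1 - F xstar) (fun k => ‖oracleAt g η b₀ x₁ k s‖)
      (fun k => ‖gradAt F g η b₀ x₁ k s‖) (fun k => ‖noiseAt F g η b₀ x₁ k s‖)
      (fun k => (state g η b₀ x₁ s k).2) (fun k => incrementAt F g η b₀ x₁ xstar k s) where
  D_nonneg _ := norm_nonneg _
  δ_nonneg _ := sub_nonneg.2 (hq.2.2.1 _)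
  a_nonneg _ := norm_nonneg _
  n_nonneg _ := norm_nonneg _
  e_nonneg _ := norm_nonneg _
  a_le k := by
    rw [noiseAt, add_comm]
    exact norm_le_norm_sub_add _ _
  n_sq_le_gap k := norm_gradient_sq_le hF hq.2.2.1 _
  n_sq_le_dist k := norm_gradient_sq_le' hF hq.2.2.1 _
  D_zero := hx
  B_zero := rfl
  B_succ _ := rfl
  step k := by
    have hB := sq_le_state_snd (g := g) (η := η) (b₀ := b₀) (x₁ := x₁) k s
    have hB' := sq_le_state_snd (g := g) (η := η) (b₀ := b₀) (x₁ := x₁) (k + 1) s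
    have hb2 : 0 < b₀ ^ 2 := by positivity
    have hc : 0 < (state g η b₀ x₁ s k).2 + ‖gradAt F g η b₀ x₁ k s‖ ^ 2 := by
      linarith [sq_nonneg ‖gradAt F g η b₀ x₁ k s‖]
    have hδ : γ * (F (state g η b₀ x₁ s k).1 - F xstar) ≤
        inner ℝ (gradAt F g η b₀ x₁ k s) ((state g η b₀ x₁ s k).1 - xstar) := by
      obtain ⟨hγ, -, -, h⟩ := hq
      have h1 := h (state g η b₀ x₁ s k).1
      rw [← neg_sub (state g η b₀ x₁ s k).1 xstar, inner_neg_right] at h1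
      have h2 : F (state g η b₀ x₁ s k).1 - F xstar ≤
          1 / γ * inner ℝ (gradAt F g η b₀ x₁ k s) ((state g η b₀ x₁ s k).1 - xstar) := by
        rw [gradAt]
        linarith
      calc _ ≤ γ * (1 / γ * inner ℝ (gradAt F g η b₀ x₁ k s)
            ((state g η b₀ x₁ s k).1 - xstar)) := by gcongr
        _ = _ := by field_simp
    have h := step_bound (y := (state g η b₀ x₁ s k).1 - xstar) (G := oracleAt g η b₀ x₁ k s)
      (n := gradAt F g η b₀ x₁ k s) hη (Real.sqrt_pos.2 (hb2.trans_le hB'))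
      (Real.sqrt_pos.2 hc) (hb2.le.trans hB)
      (by rw [Real.sq_sqrt (hb2.le.trans hB'), state_succ_snd]) (Real.sq_sqrt hc.le) hδ
    rw [Real.sq_sqrt (hb2.le.trans hB'), Real.sq_sqrt hc.le] at h
    rw [state_succ_fst, sub_right_comm]
    exact h

theorem incrementAt_sq_le (hb : 0 < b₀) (k : ℕ) (s : ℕ → S) :
    incrementAt F g η b₀ x₁ xstar k s ^ 2 ≤
      4 * η ^ 2 * (‖(state g η b₀ x₁ s k).1 - xstar‖ ^ 2 * (‖noiseAt F g η b₀ x₁ k s‖ ^ 2 /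
        ((state g η b₀ x₁ s k).2 + ‖gradAt F g η b₀ x₁ k s‖ ^ 2))) := by
  have hB := sq_le_state_snd (g := g) (η := η) (b₀ := b₀) (x₁ := x₁) k s
  have hb2 : 0 < b₀ ^ 2 := by positivity
  have hc : 0 < (state g η b₀ x₁ s k).2 + ‖gradAt F g η b₀ x₁ k s‖ ^ 2 := by
    linarith [sq_nonneg ‖gradAt F g η b₀ x₁ k s‖]
  have h1 : inner ℝ (noiseAt F g η b₀ x₁ k s) ((state g η b₀ x₁ s k).1 - xstar) ^ 2 ≤
      (‖noiseAt F g η b₀ x₁ k s‖ * ‖(state g η b₀ x₁ s k).1 - xstar‖) ^ 2 :=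
    sq_le_sq.2 ((abs_real_inner_le_norm _ _).trans (le_abs_self _))
  rw [incrementAt, weightAt, mul_pow, neg_sq, div_pow, Real.sq_sqrt hc.le]
  calc _ ≤ (2 * η) ^ 2 / ((state g η b₀ x₁ s k).2 + ‖gradAt F g η b₀ x₁ k s‖ ^ 2) *
        (‖noiseAt F g η b₀ x₁ k s‖ * ‖(state g η b₀ x₁ s k).1 - xstar‖) ^ 2 := by gcongr
    _ = _ := by ring

end Trajectory

/-! ### Measurability and adaptedness. -/

section Measurability

variable {d : ℕ} {S Ω : Type*} [MeasurableSpace S] {m : MeasurableSpace Ω}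
  {F : EuclideanSpace ℝ (Fin d) → ℝ}
  {g : EuclideanSpace ℝ (Fin d) → S → EuclideanSpace ℝ (Fin d)} {η b₀ : ℝ}
  {x₁ xstar : EuclideanSpace ℝ (Fin d)} {z : ℕ → Ω → S} {k : ℕ}

theorem measurable_gradient (F : EuclideanSpace ℝ (Fin d) → ℝ) : Measurable (gradient F) :=
  (InnerProductSpace.toDual ℝ (EuclideanSpace ℝ (Fin d))).symm.continuous.measurable.comp
    (measurable_fderiv ℝ F)

/-- The σ-algebra on Ω is left free and only the samples up to k are used, so the same statement
gives measurability for the ambient σ-algebra and adaptedness for `history z k`. -/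
theorem measurable_state (hg : Measurable (Function.uncurry g))
    (hz : ∀ i ≤ k, Measurable (z i)) :
    Measurable fun ω => state g η b₀ x₁ (fun i => z i ω) k := by
  induction k with
  | zero => exact measurable_const
  | succ k ih =>
    have h := ih fun i hi => hz i (by omega)
    have hG : Measurable fun ω => oracleAt g η b₀ x₁ k (fun i => z i ω) :=
      hg.comp (h.fst.prodMk (hz (k + 1) le_rfl))
    have hB : Measurable fun ω => (state g η b₀ x₁ (fun i => z i ω) k).2 +
        ‖oracleAt g η b₀ x₁ k (fun i => z i ω)‖ ^ 2 := h.snd.add (hG.norm.pow_const 2)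
    exact (h.fst.sub ((hB.sqrt.const_div η).smul hG)).prodMk hB

theorem measurable_gradAt (hg : Measurable (Function.uncurry g))
    (hz : ∀ i ≤ k, Measurable (z i)) :
    Measurable fun ω => gradAt F g η b₀ x₁ k (fun i => z i ω) :=
  (measurable_gradient F).comp (measurable_state hg hz).fst

theorem measurable_oracleAt (hg : Measurable (Function.uncurry g))
    (hz : ∀ i ≤ k + 1, Measurable (z i)) :
    Measurable fun ω => oracleAt g η b₀ x₁ k (fun i => z i ω) :=
  hg.comp ((measurable_state hg fun i hi => hz i (by omega)).fst.prodMk (hz (k + 1) le_rfl))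

theorem measurable_noiseAt (hg : Measurable (Function.uncurry g))
    (hz : ∀ i ≤ k + 1, Measurable (z i)) :
    Measurable fun ω => noiseAt F g η b₀ x₁ k (fun i => z i ω) :=
  (measurable_oracleAt hg hz).sub (measurable_gradAt hg fun i hi => hz i (by omega))

theorem measurable_snd_add_norm_sq (hg : Measurable (Function.uncurry g))
    (hz : ∀ i ≤ k, Measurable (z i)) :
    Measurable fun ω => (state g η b₀ x₁ (fun i => z i ω) k).2 +
      ‖gradAt F g η b₀ x₁ k (fun i => z i ω)‖ ^ 2 :=
  (measurable_state hg hz).snd.add ((measurable_gradAt hg hz).norm.pow_const 2)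

theorem measurable_weightAt (hg : Measurable (Function.uncurry g))
    (hz : ∀ i ≤ k, Measurable (z i)) :
    Measurable fun ω => weightAt F g η b₀ x₁ k (fun i => z i ω) :=
  ((measurable_snd_add_norm_sq hg hz).sqrt.const_div _).neg

theorem measurable_incrementAt (hg : Measurable (Function.uncurry g))
    (hz : ∀ i ≤ k + 1, Measurable (z i)) :
    Measurable fun ω => incrementAt F g η b₀ x₁ xstar k (fun i => z i ω) :=
  (measurable_weightAt hg fun i hi => hz i (by omega)).mul ((measurable_noiseAt hg hz).inner
    ((measurable_state hg fun i hi => hz i (by omega)).fst.sub measurable_const))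

theorem measurable_sum_incrementAt (hg : Measurable (Function.uncurry g))
    (hz : ∀ i ≤ k, Measurable (z i)) :
    Measurable fun ω => ∑ i ∈ Finset.range k, incrementAt F g η b₀ x₁ xstar i (fun i => z i ω) :=
  Finset.measurable_fun_sum _ fun _ hi => measurable_incrementAt hg fun j hj =>
    hz j (hj.trans (Finset.mem_range.1 hi))

theorem measurable_maxSum_incrementAt (hg : Measurable (Function.uncurry g))
    (hz : ∀ i ≤ k, Measurable (z i)) :
    Measurable fun ω => maxSum (fun i => incrementAt F g η b₀ x₁ xstar i (fun i => z i ω)) k :=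
  measurable_runMax fun _ hj => measurable_sum_incrementAt hg fun i hi => hz i (hi.trans hj)

theorem measurable_normSum_noiseAt (hg : Measurable (Function.uncurry g))
    (hz : ∀ i ≤ k, Measurable (z i)) :
    Measurable fun ω => normSum (fun i => ‖noiseAt F g η b₀ x₁ i (fun i => z i ω)‖)
      (fun i => ‖gradAt F g η b₀ x₁ i (fun i => z i ω)‖)
      (fun i => (state g η b₀ x₁ (fun i => z i ω) i).2) k := by
  refine Finset.measurable_fun_sum _ fun i hi => ?_
  have hi := Finset.mem_range.1 hi
  exact ((measurable_noiseAt hg fun j hj => hz j (hj.trans hi)).norm.pow_const 2).div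
    (measurable_snd_add_norm_sq hg fun j hj => hz j (by omega))

end Measurability

/-! ### Freezing the past. -/

section Independence

variable {S Ω α : Type*} [MeasurableSpace S] {z : ℕ → Ω → S}

/-- The σ-algebra generated by the samples up to time `k`. -/
abbrev history (z : ℕ → Ω → S) (k : ℕ) : MeasurableSpace Ω :=
  ⨆ i ∈ Set.Iic k, MeasurableSpace.comap (z i) inferInstance

theorem measurable_history {i k : ℕ} (h : i ≤ k) : Measurable[history z k] (z i) :=
  measurable_iff_comap_le.2
    (le_iSup₂ (f := fun i (_ : i ∈ Set.Iic k) => MeasurableSpace.comap (z i) inferInstance) i h)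

variable [MeasurableSpace Ω] [MeasurableSpace α] {μ : Measure Ω}

theorem history_le (hz : ∀ i, Measurable (z i)) (k : ℕ) : history z k ≤ ‹MeasurableSpace Ω› :=
  iSup₂_le fun i _ => (hz i).comap_le

theorem indepFun_history (hz : ∀ i, Measurable (z i)) (hi : iIndepFun z μ) {k : ℕ} {X : Ω → α}
    (hX : Measurable[history z k] X) : IndepFun X (z (k + 1)) μ := by
  have h := indep_iSup_of_disjoint (fun i => (hz i).comap_le) hi
    (S := Set.Iic k) (T := {k + 1}) (by simp)
  simp only [Set.mem_singleton_iff, iSup_iSup_eq_left] at h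
  exact indep_of_indep_of_le_left h hX.comap_le

variable [IsProbabilityMeasure μ]

/-- The oracle hypotheses concern fixed points, whereas the iterates are random. By independence the
joint law of the past and the next sample is a product, and Tonelli allows the past to be frozen.
The nonnegative version presupposes no integrability, so it can be used to prove it. -/
theorem lintegral_history (hz : ∀ i, Measurable (z i)) (hi : iIndepFun z μ) {k : ℕ} {X : Ω → α}
    (hX : Measurable[history z k] X) {f : α × S → ENNReal} (hf : Measurable f) :
    ∫⁻ ω, f (X ω, z (k + 1) ω) ∂μ = ∫⁻ ω, ∫⁻ ω', f (X ω, z (k + 1) ω') ∂μ ∂μ := by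
  have hX' : Measurable X := hX.mono (history_le hz k) le_rfl
  have hmap := (indepFun_iff_map_prod_eq_prod_map_map hX'.aemeasurable
    (hz (k + 1)).aemeasurable).1 (indepFun_history hz hi hX)
  rw [← lintegral_map hf (hX'.prodMk (hz (k + 1))), hmap, lintegral_prod _ hf.aemeasurable,
    lintegral_map hf.lintegral_prod_right' hX']
  refine lintegral_congr fun ω => ?_
  exact lintegral_map (hf.comp measurable_prodMk_left) (hz (k + 1))

theorem integral_history (hz : ∀ i, Measurable (z i)) (hi : iIndepFun z μ) {k : ℕ} {X : Ω → α}
    (hX : Measurable[history z k] X) {f : α × S → ℝ} (hf : Measurable f)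
    (hint : Integrable (fun ω => f (X ω, z (k + 1) ω)) μ) :
    ∫ ω, f (X ω, z (k + 1) ω) ∂μ = ∫ ω, ∫ ω', f (X ω, z (k + 1) ω') ∂μ ∂μ := by
  have hX' : Measurable X := hX.mono (history_le hz k) le_rfl
  have hp := hX'.prodMk (hz (k + 1))
  have hmap := (indepFun_iff_map_prod_eq_prod_map_map hX'.aemeasurable
    (hz (k + 1)).aemeasurable).1 (indepFun_history hz hi hX)
  have : IsProbabilityMeasure (μ.map (z (k + 1))) :=
    Measure.isProbabilityMeasure_map (hz (k + 1)).aemeasurable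
  have hint' : Integrable f ((μ.map X).prod (μ.map (z (k + 1)))) := by
    rw [← hmap]
    exact (integrable_map_measure hf.aestronglyMeasurable hp.aemeasurable).2 hint
  rw [← integral_map hp.aemeasurable hf.aestronglyMeasurable, hmap, integral_prod _ hint',
    integral_map hX'.aemeasurable hf.stronglyMeasurable.integral_prod_right'.aestronglyMeasurable]
  refine integral_congr_ae (Filter.Eventually.of_forall fun ω => ?_)
  exact integral_map (hz (k + 1)).aemeasurable
    (hf.comp measurable_prodMk_left).aestronglyMeasurable

end Independence

/-! ### Noise along the trajectory. -/

section Noise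

variable {d : ℕ} {S Ω : Type*} [MeasurableSpace S] [MeasurableSpace Ω] {μ : Measure Ω}
  [IsProbabilityMeasure μ] {F : EuclideanSpace ℝ (Fin d) → ℝ}
  {g : EuclideanSpace ℝ (Fin d) → S → EuclideanSpace ℝ (Fin d)} {η b₀ σ : ℝ}
  {x₁ xstar : EuclideanSpace ℝ (Fin d)} {z : ℕ → Ω → S}

/-- The noise is orthogonal to every vector which depends on the past only. -/
theorem integral_inner_noiseAt (ho : IsOracle μ g z) (hu : IsUnbiasedOracle μ F g z) {k : ℕ}
    {H : Ω → EuclideanSpace ℝ (Fin d)} (hH : Measurable[history z k] H)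
    (hint : Integrable (fun ω => inner ℝ (noiseAt F g η b₀ x₁ k (fun i => z i ω)) (H ω)) μ) :
    ∫ ω, inner ℝ (noiseAt F g η b₀ x₁ k (fun i => z i ω)) (H ω) ∂μ = 0 := by
  have hx : Measurable[history z k] fun ω => (state g η b₀ x₁ (fun i => z i ω) k).1 :=
    (measurable_state (m := history z k) ho.measurable_oracle
      fun i hi => measurable_history hi).fst
  have hg := ho.measurable_oracle
  have hgr := measurable_gradient F
  have hf : Measurable fun p : (EuclideanSpace ℝ (Fin d) × EuclideanSpace ℝ (Fin d)) × S =>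
      inner ℝ (g p.1.1 p.2 - gradient F p.1.1) p.1.2 :=
    ((hg.comp (measurable_fst.fst.prodMk measurable_snd)).sub
      (hgr.comp measurable_fst.fst)).inner measurable_fst.snd
  have h := integral_history ho.measurable_sample ho.indep (hx.prodMk hH) hf hint
  refine h.trans ?_
  rw [← integral_zero Ω ℝ (μ := μ)]
  refine integral_congr_ae (Filter.Eventually.of_forall fun ω => ?_)
  obtain ⟨hi, he⟩ := hu (k + 1) (by omega) (state g η b₀ x₁ (fun i => z i ω) k).1
  simp only [real_inner_comm (H ω)]
  refine (integral_inner (hi.sub (integrable_const _)) (H ω)).trans ?_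
  simp only [Pi.sub_apply]
  rw [integral_sub hi (integrable_const _), he]
  simp

theorem integrable_exp_noiseAt (ho : IsOracle μ g z) (hn : HasSubGaussianNoise μ F g z σ)
    (hσ : 0 < σ) (k : ℕ) :
    Integrable (fun ω => Real.exp (‖noiseAt F g η b₀ x₁ k (fun i => z i ω)‖ ^ 2 / σ ^ 2)) μ ∧
      ∫ ω, Real.exp (‖noiseAt F g η b₀ x₁ k (fun i => z i ω)‖ ^ 2 / σ ^ 2) ∂μ ≤ Real.exp 1 := by
  have hx : Measurable[history z k] fun ω => (state g η b₀ x₁ (fun i => z i ω) k).1 :=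
    (measurable_state (m := history z k) ho.measurable_oracle
      fun i hi => measurable_history hi).fst
  have hg := ho.measurable_oracle
  have hgr := measurable_gradient F
  have hf : Measurable fun p : EuclideanSpace ℝ (Fin d) × S =>
      ENNReal.ofReal (Real.exp (‖g p.1 p.2 - gradient F p.1‖ ^ 2 / σ ^ 2)) :=
    (Real.measurable_exp.comp (((hg.sub (hgr.comp measurable_fst)).norm.pow_const 2).div_const
      _)).ennreal_ofReal
  have hm : Measurable fun ω =>
      Real.exp (‖noiseAt F g η b₀ x₁ k (fun i => z i ω)‖ ^ 2 / σ ^ 2) :=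
    Real.measurable_exp.comp (((measurable_noiseAt hg
      fun i _ => ho.measurable_sample i).norm.pow_const 2).div_const _)
  have h := lintegral_history ho.measurable_sample ho.indep hx hf
  have hle : ∫⁻ ω, ENNReal.ofReal
      (Real.exp (‖noiseAt F g η b₀ x₁ k (fun i => z i ω)‖ ^ 2 / σ ^ 2)) ∂μ ≤
      ENNReal.ofReal (Real.exp 1) := by
    refine h.le.trans ?_
    calc _ ≤ ∫⁻ _, ENNReal.ofReal (Real.exp 1) ∂μ := by
          refine lintegral_mono fun ω => ?_
          obtain ⟨hi, he⟩ := (hn (k + 1) (by omega)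
            (state g η b₀ x₁ (fun i => z i ω) k).1).1 hσ
          rw [← ofReal_integral_eq_lintegral_ofReal hi
            (Filter.Eventually.of_forall fun _ => (Real.exp_pos _).le)]
          exact ENNReal.ofReal_le_ofReal he
      _ = _ := by simp
  have hint : Integrable (fun ω =>
      Real.exp (‖noiseAt F g η b₀ x₁ k (fun i => z i ω)‖ ^ 2 / σ ^ 2)) μ :=
    (lintegral_ofReal_ne_top_iff_integrable hm.aestronglyMeasurable
      (Filter.Eventually.of_forall fun _ => (Real.exp_pos _).le)).1
      (ne_top_of_le_ne_top ENNReal.ofReal_ne_top hle)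
  refine ⟨hint, ?_⟩
  rw [← ofReal_integral_eq_lintegral_ofReal hint
    (Filter.Eventually.of_forall fun _ => (Real.exp_pos _).le)] at hle
  exact (ENNReal.ofReal_le_ofReal_iff (Real.exp_pos _).le).1 hle

theorem noiseAt_ae_eq_zero (ho : IsOracle μ g z) (hn : HasSubGaussianNoise μ F g z 0) (k : ℕ) :
    ∀ᵐ ω ∂μ, noiseAt F g η b₀ x₁ k (fun i => z i ω) = 0 := by
  have hx : Measurable[history z k] fun ω => (state g η b₀ x₁ (fun i => z i ω) k).1 :=
    (measurable_state (m := history z k) ho.measurable_oracle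
      fun i hi => measurable_history hi).fst
  have hg := ho.measurable_oracle
  have hgr := measurable_gradient F
  have hf : Measurable fun p : EuclideanSpace ℝ (Fin d) × S =>
      ENNReal.ofReal ‖g p.1 p.2 - gradient F p.1‖ :=
    (hg.sub (hgr.comp measurable_fst)).norm.ennreal_ofReal
  have hm : Measurable fun ω => ENNReal.ofReal ‖noiseAt F g η b₀ x₁ k (fun i => z i ω)‖ :=
    (measurable_noiseAt hg fun i _ => ho.measurable_sample i).norm.ennreal_ofReal
  have h := lintegral_history ho.measurable_sample ho.indep hx hf
  have h0 : ∫⁻ ω, ENNReal.ofReal ‖noiseAt F g η b₀ x₁ k (fun i => z i ω)‖ ∂μ = 0 := by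
    refine Eq.trans h ?_
    rw [← lintegral_zero (μ := μ)]
    refine lintegral_congr fun ω => ?_
    rw [← lintegral_zero (μ := μ)]
    refine lintegral_congr_ae ?_
    filter_upwards [(hn (k + 1) (by omega) (state g η b₀ x₁ (fun i => z i ω) k).1).2 rfl]
      with ω' hω'
    simp [hω']
  filter_upwards [(lintegral_eq_zero_iff hm).1 h0] with ω hω
  simpa using hω

theorem noiseAt_moments (ho : IsOracle μ g z) (hσ : 0 ≤ σ)
    (hn : HasSubGaussianNoise μ F g z σ) (k : ℕ) :
    HasMoments (fun ω => ‖noiseAt F g η b₀ x₁ k (fun i => z i ω)‖) μ := by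
  have hm : Measurable fun ω => ‖noiseAt F g η b₀ x₁ k (fun i => z i ω)‖ :=
    (measurable_noiseAt ho.measurable_oracle fun i _ => ho.measurable_sample i).norm
  refine ⟨hm, fun p => ?_⟩
  rcases hσ.eq_or_lt with rfl | hσ
  -- The constant is 0 ^ p rather than 0 because p = 0 is included.
  · refine (integrable_const ((0 : ℝ) ^ p)).congr ?_
    filter_upwards [noiseAt_ae_eq_zero (η := η) (b₀ := b₀) (x₁ := x₁) ho hn k] with ω hω
    simp [hω]
  · refine ((integrable_const 1).add ((integrable_exp_noiseAt (η := η) (b₀ := b₀) (x₁ := x₁)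
      ho hn hσ k).1.const_mul (σ ^ (2 * p) * p.factorial))).mono'
      (by simpa only [abs_norm] using (hm.pow_const p).aestronglyMeasurable)
      (Filter.Eventually.of_forall fun ω => ?_)
    rw [Real.norm_eq_abs, abs_of_nonneg (by positivity), abs_of_nonneg (norm_nonneg _),
      Pi.add_apply]
    have hr := norm_nonneg (noiseAt F g η b₀ x₁ k (fun i => z i ω))
    generalize ‖noiseAt F g η b₀ x₁ k (fun i => z i ω)‖ = r at hr
    -- One term of the exponential series: r^{2p} ≤ σ^{2p} p! exp(r²/σ²).
    have h1 := Real.pow_div_factorial_le_exp (r ^ 2 / σ ^ 2) (by positivity) p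
    rw [div_le_iff₀ (by positivity), div_pow, div_le_iff₀ (by positivity), ← pow_mul,
      ← pow_mul] at h1
    have h2 := pow_le_one_add_pow hr (show p ≤ 2 * p by omega)
    linarith

end Noise

/-! ### From the oracle to random trajectories, and moments of sub-Gaussian noise. -/

section Oracle

variable {d : ℕ} {S : Type*} {Ω : Type u} [MeasurableSpace S] [MeasurableSpace Ω] {μ : Measure Ω}
  [IsProbabilityMeasure μ] {F : EuclideanSpace ℝ (Fin d) → ℝ}
  {g : EuclideanSpace ℝ (Fin d) → S → EuclideanSpace ℝ (Fin d)} {γ L η b₀ R σ : ℝ}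
  {x₁ xstar : EuclideanSpace ℝ (Fin d)} {z : ℕ → Ω → S}

/-- AdaGradNorm run with a stochastic oracle is a random trajectory. -/
theorem stochPath_of_oracle (hη : 0 < η) (hb : 0 < b₀) (hdiff : Differentiable ℝ F)
    (hq : IsQuasarConvex γ F xstar) (hF : IsSmoothWith L F) (hx : ‖x₁ - xstar‖ ≤ R)
    (hσ : 0 ≤ σ) (ho : IsOracle μ g z) (hu : IsUnbiasedOracle μ F g z)
    (hn : HasSubGaussianNoise μ F g z σ) :
    StochPath μ γ L η b₀ R
      (fun k ω => ‖(state g η b₀ x₁ (fun i => z i ω) k).1 - xstar‖)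
      (fun k ω => F (state g η b₀ x₁ (fun i => z i ω) k).1 - F xstar)
      (fun k ω => ‖oracleAt g η b₀ x₁ k (fun i => z i ω)‖)
      (fun k ω => ‖gradAt F g η b₀ x₁ k (fun i => z i ω)‖)
      (fun k ω => ‖noiseAt F g η b₀ x₁ k (fun i => z i ω)‖)
      (fun k ω => (state g η b₀ x₁ (fun i => z i ω) k).2)
      (fun k ω => incrementAt F g η b₀ x₁ xstar k (fun i => z i ω)) := by
  have hg := ho.measurable_oracle
  have hz : ∀ k, ∀ i ≤ k, Measurable (z i) := fun k i _ => ho.measurable_sample i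
  have hh : ∀ k, ∀ i ≤ k, Measurable[history z k] (z i) := fun k i hi => measurable_history hi
  have hL := hF.1
  have path := fun ω => path_of_seeds (γ := γ) (L := L) (R := R) (g := g) hη hb hq hF hx
    (fun i => z i ω)
  have mx : ∀ k, Measurable fun ω => (state g η b₀ x₁ (fun i => z i ω) k).1 := fun k =>
    (measurable_state hg (hz k)).fst
  have mD : ∀ k, HasMoments (fun ω => ‖(state g η b₀ x₁ (fun i => z i ω) k).1 - xstar‖) μ :=
    fun k => (HasMoments.const (R + η * k)).of_le ((mx k).sub measurable_const).norm
      (fun ω => norm_nonneg _) fun ω => norm_state_sub_le hη hb hx k _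
  have me : ∀ k, HasMoments (fun ω => ‖noiseAt F g η b₀ x₁ k (fun i => z i ω)‖) μ :=
    noiseAt_moments ho hσ hn
  have mn : ∀ k, HasMoments (fun ω => ‖gradAt F g η b₀ x₁ k (fun i => z i ω)‖) μ := fun k =>
    ((mD k).const_mul L).of_le (measurable_gradAt hg (hz k)).norm (fun ω => norm_nonneg _)
      fun ω => le_of_sq_le_sq (by rw [mul_pow]; exact (path ω).n_sq_le_dist k) (by positivity)
  have ma : ∀ k, HasMoments (fun ω => ‖oracleAt g η b₀ x₁ k (fun i => z i ω)‖) μ := fun k =>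
    ((mn k).add (me k)).of_le (measurable_oracleAt hg (hz (k + 1))).norm
      (fun ω => norm_nonneg _) fun ω => (path ω).a_le k
  have mB : ∀ k, HasMoments (fun ω => (state g η b₀ x₁ (fun i => z i ω) k).2) μ := fun k => by
    induction k with
    | zero => exact HasMoments.const (b₀ ^ 2)
    | succ k ih => exact ih.add ((ma k).pow 2)
  have hc : ∀ k ω, b₀ ^ 2 ≤ (state g η b₀ x₁ (fun i => z i ω) k).2 +
      ‖gradAt F g η b₀ x₁ k (fun i => z i ω)‖ ^ 2 := fun k ω =>
    (sq_le_state_snd k _).trans (le_add_of_nonneg_right (sq_nonneg _))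
  have hb2 : 0 < b₀ ^ 2 := by positivity
  have my : ∀ k, HasMoments (fun ω => incrementAt F g η b₀ x₁ xstar k (fun i => z i ω)) μ :=
    fun k => (((mD k).mul (me k)).const_mul (2 * η / b₀)).of_abs_le
      (measurable_incrementAt hg (hz (k + 1))) fun ω => by
        refine sq_le_sq.1 ((incrementAt_sq_le hb k _).trans ?_)
        rw [mul_pow, div_pow, mul_pow, mul_pow]
        calc _ ≤ 4 * η ^ 2 * (‖(state g η b₀ x₁ (fun i => z i ω) k).1 - xstar‖ ^ 2 *
              (‖noiseAt F g η b₀ x₁ k (fun i => z i ω)‖ ^ 2 / b₀ ^ 2)) := by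
              gcongr
              exact hc k ω
          _ = _ := by ring
  -- The increment times a past-measurable factor is the noise paired with a past-measurable vector,
  -- so it integrates to zero by unbiasedness.
  have morth : ∀ k, ∀ A : Ω → ℝ, Measurable[history z k] A → HasMoments A μ →
      ∫ ω, A ω * incrementAt F g η b₀ x₁ xstar k (fun i => z i ω) ∂μ = 0 := by
    intro k A hA mA
    have heq : ∀ ω, A ω * incrementAt F g η b₀ x₁ xstar k (fun i => z i ω) =
        inner ℝ (noiseAt F g η b₀ x₁ k (fun i => z i ω))
          ((A ω * weightAt F g η b₀ x₁ k (fun i => z i ω)) •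
            ((state g η b₀ x₁ (fun i => z i ω) k).1 - xstar)) := fun ω => by
      rw [inner_smul_right, incrementAt]
      ring
    have hint := (mA.mul (my k)).integrable
    simp only [heq] at hint ⊢
    exact integral_inner_noiseAt ho hu
      ((hA.mul (measurable_weightAt (m := history z k) hg (hh k))).smul
        ((measurable_state (m := history z k) hg (hh k)).fst.sub measurable_const)) hint
  refine ⟨path, fun k => ?_, ma, mn, me, mB, my, fun k => ?_, fun k => ?_,
    fun k ω => incrementAt_sq_le hb k _, fun k => ?_⟩
  · refine (((mD k).pow 2).const_mul (L / 2)).of_le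
      ((hdiff.continuous.measurable.comp (mx k)).sub measurable_const)
      (fun ω => (path ω).δ_nonneg k) fun ω => sub_min_le hF hq.2.2.1 _
  · exact morth k _ (measurable_sum_incrementAt (m := history z k) hg (hh k))
      (HasMoments.sum my k)
  · exact morth k _ (measurable_maxSum_incrementAt (m := history z k) hg (hh k))
      (HasMoments.maxSum my k)
  · have mdiv : ∀ {f : ℕ → Ω → ℝ}, (∀ k, HasMoments (f k) μ) → ∀ k, HasMoments (fun ω =>
        f k ω ^ 2 / ((state g η b₀ x₁ (fun i => z i ω) k).2 +
          ‖gradAt F g η b₀ x₁ k (fun i => z i ω)‖ ^ 2)) μ := fun {f} hf k =>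
      (((hf k).pow 2).const_mul (1 / b₀ ^ 2)).of_le
        (((hf k).measurable.pow_const 2).div ((mB k).measurable.add
          ((mn k).measurable.pow_const 2)))
        (fun ω => div_nonneg (sq_nonneg _) (hb2.le.trans (hc k ω))) fun ω => by
          rw [one_div, inv_mul_eq_div]
          gcongr
          exact hc k ω
    have hA : Measurable[history z k] fun ω =>
        normSum (fun i => ‖noiseAt F g η b₀ x₁ i (fun i => z i ω)‖)
          (fun i => ‖gradAt F g η b₀ x₁ i (fun i => z i ω)‖)
          (fun i => (state g η b₀ x₁ (fun i => z i ω) i).2) k :=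
      measurable_normSum_noiseAt (m := history z k) hg (hh k)
    have hN := measurable_gradAt (m := history z k) (F := F) (η := η) (b₀ := b₀) (x₁ := x₁)
      hg (hh k)
    have hB := measurable_snd_add_norm_sq (m := history z k) (F := F) (η := η) (b₀ := b₀)
      (x₁ := x₁) hg (hh k)
    set W := fun ω => normSum (fun i => ‖noiseAt F g η b₀ x₁ i (fun i => z i ω)‖)
          (fun i => ‖gradAt F g η b₀ x₁ i (fun i => z i ω)‖)
          (fun i => (state g η b₀ x₁ (fun i => z i ω) i).2) k with hW
    have mW : HasMoments W μ := HasMoments.sum (mdiv me) k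
    have hW0 : ∀ ω, 0 ≤ W ω := fun ω => (path ω).normSum_nonneg hb _ k
    -- The cross term in ‖ξ + ∇F‖² = ‖ξ‖² + ‖∇F‖² + 2⟨ξ, ∇F⟩, ξ the noise, with its past-measurable
    -- weight W³/c². It integrates to zero, and dropping ‖∇F‖² gives the inequality.
    set H : Ω → EuclideanSpace ℝ (Fin d) := fun ω =>
      (2 * (W ω ^ 3 / ((state g η b₀ x₁ (fun i => z i ω) k).2 +
        ‖gradAt F g η b₀ x₁ k (fun i => z i ω)‖ ^ 2))) • gradAt F g η b₀ x₁ k (fun i => z i ω)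
      with hH
    have hHm : Measurable[history z k] H :=
      (((hA.pow_const 3).div hB).const_mul 2).smul hN
    have hexp : ∀ ω, W ω ^ 3 * (‖oracleAt g η b₀ x₁ k (fun i => z i ω)‖ ^ 2 /
        ((state g η b₀ x₁ (fun i => z i ω) k).2 +
        ‖gradAt F g η b₀ x₁ k (fun i => z i ω)‖ ^ 2)) =
        W ω ^ 3 * (‖noiseAt F g η b₀ x₁ k (fun i => z i ω)‖ ^ 2 /
        ((state g η b₀ x₁ (fun i => z i ω) k).2 +
        ‖gradAt F g η b₀ x₁ k (fun i => z i ω)‖ ^ 2)) +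
        W ω ^ 3 * (‖gradAt F g η b₀ x₁ k (fun i => z i ω)‖ ^ 2 /
        ((state g η b₀ x₁ (fun i => z i ω) k).2 +
        ‖gradAt F g η b₀ x₁ k (fun i => z i ω)‖ ^ 2)) +
        inner ℝ (noiseAt F g η b₀ x₁ k (fun i => z i ω)) (H ω) := fun ω => by
      have h1 : oracleAt g η b₀ x₁ k (fun i => z i ω) =
          noiseAt F g η b₀ x₁ k (fun i => z i ω) + gradAt F g η b₀ x₁ k (fun i => z i ω) := by
        rw [noiseAt, sub_add_cancel]
      rw [h1, norm_add_sq_real, hH, inner_smul_right]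
      ring
    have m1 := (mW.pow 3).mul (mdiv me k)
    have m2 := (mW.pow 3).mul (mdiv mn k)
    have m3 := (mW.pow 3).mul (mdiv ma k)
    have hint : Integrable (fun ω => inner ℝ (noiseAt F g η b₀ x₁ k (fun i => z i ω)) (H ω)) μ := by
      refine (m3.integrable.sub (m1.integrable.add m2.integrable)).congr
        (Filter.Eventually.of_forall fun ω => ?_)
      have := hexp ω
      simp only [Pi.sub_apply, Pi.add_apply]
      change W ω ^ 3 * _ - (W ω ^ 3 * _ + W ω ^ 3 * _) = _
      linarith
    have h0 := integral_inner_noiseAt ho hu hHm hint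
    have hsum : ∫ ω, W ω ^ 3 * (‖oracleAt g η b₀ x₁ k (fun i => z i ω)‖ ^ 2 /
        ((state g η b₀ x₁ (fun i => z i ω) k).2 +
        ‖gradAt F g η b₀ x₁ k (fun i => z i ω)‖ ^ 2)) ∂μ =
        ∫ ω, W ω ^ 3 * (‖noiseAt F g η b₀ x₁ k (fun i => z i ω)‖ ^ 2 /
        ((state g η b₀ x₁ (fun i => z i ω) k).2 +
        ‖gradAt F g η b₀ x₁ k (fun i => z i ω)‖ ^ 2)) ∂μ +
        ∫ ω, W ω ^ 3 * (‖gradAt F g η b₀ x₁ k (fun i => z i ω)‖ ^ 2 /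
        ((state g η b₀ x₁ (fun i => z i ω) k).2 +
        ‖gradAt F g η b₀ x₁ k (fun i => z i ω)‖ ^ 2)) ∂μ := by
      refine (integral_congr_ae (Filter.Eventually.of_forall hexp)).trans ?_
      rw [integral_add (m1.add m2).integrable hint, h0, add_zero, m1.integral_add m2]
    refine le_trans (le_add_of_nonneg_right ?_) hsum.ge
    exact integral_nonneg fun ω => mul_nonneg (pow_nonneg (hW0 ω) 3)
      (div_nonneg (sq_nonneg _) (hb2.le.trans (hc k ω)))

/-- Splits x = l + (x - l) and applies the exponential series to x - l. The shift l is chosen as the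
logarithm of a bound on the size of exp x, so that the last term has bounded mean. -/
theorem pow_eight_le_exp {x l : ℝ} (hx : 0 ≤ x) (hl : 0 ≤ l) :
    x ^ 8 ≤ 2 ^ 7 * (l ^ 8 + 40320 * (Real.exp x / Real.exp l)) := by
  have h0 : 0 ≤ 40320 * (Real.exp x / Real.exp l) := by positivity
  rcases le_total x l with h | h
  · have h1 := pow_le_pow_left₀ hx h 8
    have h2 : 0 ≤ l ^ 8 := by positivity
    linarith
  · have h1 := add_pow_le hl (sub_nonneg.2 h) 8
    have h2 := Real.pow_div_factorial_le_exp _ (sub_nonneg.2 h) 8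
    rw [Real.exp_sub, div_le_iff₀ (by positivity)] at h2
    have h3 : ((Nat.factorial 8 : ℕ) : ℝ) = 40320 := by norm_num [Nat.factorial]
    rw [h3] at h2
    rw [add_sub_cancel] at h1
    norm_num at h1 ⊢
    linarith

/-- Union bound in exponential form; the 1 accounts for the initial value 0 of the running maximum.
-/
theorem exp_runMax_div_le (f : ℕ → ℝ) (c : ℝ) (k : ℕ) :
    Real.exp (runMax f k / c) ≤ 1 + ∑ i ∈ Finset.range k, Real.exp (f i / c) := by
  induction k with
  | zero => simp [runMax]
  | succ k ih =>
    have h1 := Real.exp_pos (f k / c)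
    have h2 : 0 ≤ ∑ i ∈ Finset.range k, Real.exp (f i / c) :=
      Finset.sum_nonneg fun _ _ => (Real.exp_pos _).le
    rw [Finset.sum_range_succ]
    rcases max_choice (runMax f k) (f k) with h | h <;> rw [runMax, h] <;> linarith

/-- Moments of noise with sub-Gaussian tails: the maximum, the sum of squares and its logarithm. -/
theorem noise_moment_bounds (hσ : 0 < σ) {e : ℕ → Ω → ℝ} (he : ∀ k, HasMoments (e k) μ)
    (hexp : ∀ k, Integrable (fun ω => Real.exp (e k ω ^ 2 / σ ^ 2)) μ ∧
      ∫ ω, Real.exp (e k ω ^ 2 / σ ^ 2) ∂μ ≤ Real.exp 1) {T : ℕ} (hT : 1 ≤ T) :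
    ∫ ω, ∑ k ∈ Finset.range T, e k ω ^ 2 ∂μ ≤ 2 * σ ^ 2 * T ∧
      ∫ ω, runMax (fun k => e k ω ^ 2) T ^ 8 ∂μ ≤
        2 ^ 7 * ((σ ^ 2 * Real.log T) ^ 8 + 161280 * (σ ^ 2) ^ 8) ∧
      ∫ ω, Real.log (1 + ∑ k ∈ Finset.range T, e k ω ^ 2) ^ 8 ∂μ ≤
        2 ^ 7 * (Real.log (1 + 2 * σ ^ 2 * T) ^ 8 + 40320) := by
  have hT' : (1 : ℝ) ≤ T := by exact_mod_cast hT
  have he3 : Real.exp 1 ≤ 3 := Real.exp_one_lt_three.le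
  have hm2 := fun k => (he k).pow 2
  have hsum := HasMoments.sum hm2 T
  have hs0 : ∀ ω, 0 ≤ ∑ k ∈ Finset.range T, e k ω ^ 2 := fun ω =>
    Finset.sum_nonneg fun _ _ => sq_nonneg _
  have h1 : ∫ ω, ∑ k ∈ Finset.range T, e k ω ^ 2 ∂μ ≤ 2 * σ ^ 2 * T := by
    rw [integral_finsetSum _ fun k _ => (hm2 k).integrable]
    calc _ ≤ ∑ k ∈ Finset.range T, 2 * σ ^ 2 := by
          refine Finset.sum_le_sum fun k _ => ?_
          have hk : ∫ ω, e k ω ^ 2 ∂μ ≤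
              ∫ ω, σ ^ 2 * (Real.exp (e k ω ^ 2 / σ ^ 2) - 1) ∂μ := by
            refine integral_mono (hm2 k).integrable
              (((hexp k).1.sub (integrable_const 1)).const_mul _) fun ω => ?_
            calc e k ω ^ 2 = σ ^ 2 * (e k ω ^ 2 / σ ^ 2) := by field_simp
              _ ≤ _ := by
                gcongr
                linarith [Real.add_one_le_exp (e k ω ^ 2 / σ ^ 2)]
          rw [integral_const_mul, integral_sub (hexp k).1 (integrable_const 1)] at hk
          simp only [integral_const, probReal_univ, one_smul] at hk
          have : σ ^ 2 * (∫ ω, Real.exp (e k ω ^ 2 / σ ^ 2) ∂μ - 1) ≤ σ ^ 2 * 2 := by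
            gcongr
            linarith [(hexp k).2]
          linarith
      _ = _ := by
        simp
        ring
  refine ⟨h1, ?_, ?_⟩
  · have hS := HasMoments.runMax hm2 T
    have hpt : ∀ ω, runMax (fun k => e k ω ^ 2) T ^ 8 ≤ 2 ^ 7 * (σ ^ 2) ^ 8 *
        (Real.log T ^ 8 + 40320 / T *
          (1 + ∑ k ∈ Finset.range T, Real.exp (e k ω ^ 2 / σ ^ 2))) := fun ω => by
      have h2 := pow_eight_le_exp
        (div_nonneg (runMax_nonneg (fun k => e k ω ^ 2) T) (sq_nonneg σ)) (Real.log_nonneg hT')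
      rw [Real.exp_log (by linarith)] at h2
      calc runMax (fun k => e k ω ^ 2) T ^ 8 =
            (σ ^ 2) ^ 8 * (runMax (fun k => e k ω ^ 2) T / σ ^ 2) ^ 8 := by field_simp
        _ ≤ (σ ^ 2) ^ 8 * (2 ^ 7 * (Real.log T ^ 8 + 40320 *
            ((1 + ∑ k ∈ Finset.range T, Real.exp (e k ω ^ 2 / σ ^ 2)) / T))) := by
            refine mul_le_mul_of_nonneg_left (h2.trans ?_) (by positivity)
            gcongr
            exact exp_runMax_div_le (fun k => e k ω ^ 2) (σ ^ 2) T
        _ = _ := by ring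
    have hIs : Integrable (fun ω => ∑ k ∈ Finset.range T, Real.exp (e k ω ^ 2 / σ ^ 2)) μ :=
      integrable_finsetSum _ fun k _ => (hexp k).1
    have hI1 : Integrable
        (fun ω => 1 + ∑ k ∈ Finset.range T, Real.exp (e k ω ^ 2 / σ ^ 2)) μ :=
      (integrable_const 1).add hIs
    refine (integral_mono (hS.pow 8).integrable
      (((integrable_const _).add (hI1.const_mul _)).const_mul _) hpt).trans ?_
    simp only [Pi.add_apply]
    rw [integral_const_mul, integral_add (integrable_const _) (hI1.const_mul _),
      integral_const_mul, integral_add (integrable_const _) hIs,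
      integral_finsetSum _ fun k _ => (hexp k).1]
    simp only [integral_const, probReal_univ, one_smul]
    have h3 : ∑ k ∈ Finset.range T, ∫ ω, Real.exp (e k ω ^ 2 / σ ^ 2) ∂μ ≤ 3 * T := by
      calc _ ≤ ∑ k ∈ Finset.range T, (3 : ℝ) :=
            Finset.sum_le_sum fun k _ => (hexp k).2.trans he3
        _ = _ := by
          simp
          ring
    -- 1 + 3T ≤ T + 3T = 4T, and the shift by log T cancels T; 4·8! = 161280.
    calc _ ≤ 2 ^ 7 * (σ ^ 2) ^ 8 * (Real.log T ^ 8 + 40320 / T * (T + 3 * T)) := by gcongr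
      _ = _ := by
        field_simp
        ring
  · have hpos : 0 < 1 + 2 * σ ^ 2 * T := by positivity
    have hlogm : HasMoments (fun ω => Real.log (1 + ∑ k ∈ Finset.range T, e k ω ^ 2)) μ := by
      have hm := hsum.measurable
      exact ((HasMoments.const 1).add hsum).of_le (by fun_prop)
        (fun ω => Real.log_nonneg (by linarith [hs0 ω]))
        (fun ω => Real.log_le_self (by linarith [hs0 ω]))
    have hpt : ∀ ω, Real.log (1 + ∑ k ∈ Finset.range T, e k ω ^ 2) ^ 8 ≤
        2 ^ 7 * (Real.log (1 + 2 * σ ^ 2 * T) ^ 8 + 40320 / (1 + 2 * σ ^ 2 * T) *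
          (1 + ∑ k ∈ Finset.range T, e k ω ^ 2)) := fun ω => by
      have hp : 0 < 1 + ∑ k ∈ Finset.range T, e k ω ^ 2 := by linarith [hs0 ω]
      have h2 := pow_eight_le_exp
        (Real.log_nonneg (show 1 ≤ 1 + ∑ k ∈ Finset.range T, e k ω ^ 2 by linarith [hs0 ω]))
        (Real.log_nonneg (show 1 ≤ 1 + 2 * σ ^ 2 * T by
          have : 0 ≤ 2 * σ ^ 2 * T := by positivity
          linarith))
      rw [Real.exp_log hp, Real.exp_log hpos] at h2
      refine h2.trans (le_of_eq ?_)
      ring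
    have hm1 := (HasMoments.const (μ := μ) 1).add hsum
    refine ((hlogm.pow 8).integral_mono
      (((HasMoments.const _).add (hm1.const_mul _)).const_mul _) hpt).trans ?_
    rw [integral_const_mul, (HasMoments.const _).integral_add (hm1.const_mul _),
      integral_const_mul, (HasMoments.const 1).integral_add hsum]
    simp only [integral_const, probReal_univ, one_smul]
    calc _ ≤ 2 ^ 7 * (Real.log (1 + 2 * σ ^ 2 * T) ^ 8 + 40320 / (1 + 2 * σ ^ 2 * T) *
          (1 + 2 * σ ^ 2 * T)) := by gcongr
      _ = _ := by field_simp

end Oracle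

/-! ### The final scale: T ≥ 2 makes log T bounded below. -/

theorem half_le_log {T : ℕ} (hT : 2 ≤ T) : 1 / 2 ≤ Real.log T := by
  have h1 : Real.log 2 ≤ Real.log T := Real.log_le_log (by norm_num) (by exact_mod_cast hT)
  linarith [Real.log_two_gt_d9]

/-- 1 + 2a ≤ 4(1 + al) because l ≥ 1/2, and log 4 < 2. This inserts the factor log T in the argument
of the logarithm. -/
theorem log_one_add_pow_eight_le {a l : ℝ} (ha : 0 ≤ a) (hl : 1 / 2 ≤ l) :
    Real.log (1 + 2 * a) ^ 8 ≤ 2 ^ 15 * (1 + Real.log (1 + a * l) ^ 8) := by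
  have h0 : 0 ≤ a * l := by positivity
  have h1 : Real.log (1 + 2 * a) ≤ 2 + Real.log (1 + a * l) := by
    have h2 : 1 + 2 * a ≤ 4 * (1 + a * l) := by nlinarith
    refine (Real.log_le_log (by positivity) h2).trans ?_
    rw [Real.log_mul (by norm_num) (by positivity), show (4 : ℝ) = 2 ^ 2 by norm_num, Real.log_pow]
    push_cast
    linarith [Real.log_two_lt_d9]
  have h3 := Real.log_nonneg (show 1 ≤ 1 + a * l by linarith)
  have h4 := pow_le_pow_left₀ (Real.log_nonneg (show 1 ≤ 1 + 2 * a by linarith)) h1 8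
  have h5 := add_pow_le (show (0 : ℝ) ≤ 2 by norm_num) h3 8
  have h6 : 0 ≤ Real.log (1 + a * l) ^ 8 := by positivity
  norm_num at h5 ⊢
  linarith

/-- Moments of the noise along the trajectory, in the scale of the final estimate. -/
theorem noiseAt_moment_bounds {d : ℕ} {S : Type*} {Ω : Type u} [MeasurableSpace S]
    [MeasurableSpace Ω] {μ : Measure Ω} [IsProbabilityMeasure μ]
    {F : EuclideanSpace ℝ (Fin d) → ℝ}
    {g : EuclideanSpace ℝ (Fin d) → S → EuclideanSpace ℝ (Fin d)} {η b₀ σ : ℝ}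
    {x₁ : EuclideanSpace ℝ (Fin d)} {z : ℕ → Ω → S} (hσ : 0 ≤ σ) (ho : IsOracle μ g z)
    (hn : HasSubGaussianNoise μ F g z σ) {T : ℕ} (hT : 2 ≤ T) :
    ∫ ω, ∑ k ∈ Finset.range T, ‖noiseAt F g η b₀ x₁ k (fun i => z i ω)‖ ^ 2 ∂μ ≤
        (2 * σ * √T) ^ 2 ∧
      1 + ∫ ω, runMax (fun k => ‖noiseAt F g η b₀ x₁ k (fun i => z i ω)‖ ^ 2) T ^ 8 ∂μ +
      ∫ ω, Real.log (1 + ∑ k ∈ Finset.range T,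
        ‖noiseAt F g η b₀ x₁ k (fun i => z i ω)‖ ^ 2) ^ 8 ∂μ ≤
        2 ^ 34 * (1 + ((σ ^ 2 * Real.log T) ^ 8 +
          Real.log (1 + σ ^ 2 * T * Real.log T) ^ 8)) := by
  have hl := half_le_log hT
  have hsq : (2 * σ * √T) ^ 2 = 4 * σ ^ 2 * T := by
    rw [mul_pow, Real.sq_sqrt (Nat.cast_nonneg T)]
    ring
  rw [hsq]
  rcases hσ.eq_or_lt with rfl | hσ
  · have hz : ∀ᵐ ω ∂μ, ∀ k, noiseAt F g η b₀ x₁ k (fun i => z i ω) = 0 :=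
      ae_all_iff.2 fun k => noiseAt_ae_eq_zero ho hn k
    have hr : runMax (fun _ => (0 : ℝ)) T = 0 :=
      le_antisymm (by simpa using runMax_le_sum_abs (fun _ => (0 : ℝ)) T) (runMax_nonneg _ _)
    have h1 : ∫ ω, ∑ k ∈ Finset.range T,
        ‖noiseAt F g η b₀ x₁ k (fun i => z i ω)‖ ^ 2 ∂μ = 0 :=
      integral_eq_zero_of_ae (by filter_upwards [hz] with ω hω; simp [hω])
    have h2 : ∫ ω, runMax (fun k => ‖noiseAt F g η b₀ x₁ k (fun i => z i ω)‖ ^ 2) T ^ 8 ∂μ = 0 :=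
      integral_eq_zero_of_ae (by filter_upwards [hz] with ω hω; simp [hω, hr])
    have h3 : ∫ ω, Real.log (1 + ∑ k ∈ Finset.range T,
        ‖noiseAt F g η b₀ x₁ k (fun i => z i ω)‖ ^ 2) ^ 8 ∂μ = 0 :=
      integral_eq_zero_of_ae (by filter_upwards [hz] with ω hω; simp [hω])
    rw [h1, h2, h3]
    norm_num
  · obtain ⟨h1, h2, h3⟩ := noise_moment_bounds hσ
      (noiseAt_moments (η := η) (b₀ := b₀) (x₁ := x₁) ho hσ.le hn)
      (integrable_exp_noiseAt ho hn hσ) (show 1 ≤ T by omega)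
    have hσT : 0 ≤ σ ^ 2 * T := by positivity
    refine ⟨h1.trans (by linarith), ?_⟩
    have h4 := log_one_add_pow_eight_le hσT hl
    rw [← mul_assoc] at h4
    have h5 : (σ ^ 2) ^ 8 ≤ 2 ^ 8 * (σ ^ 2 * Real.log T) ^ 8 := by
      rw [← mul_pow]
      refine pow_le_pow_left₀ (by positivity) ?_ 8
      nlinarith [sq_nonneg σ]
    have h6 : 0 ≤ (σ ^ 2 * Real.log T) ^ 8 := by positivity
    have h7 : 0 ≤ Real.log (1 + σ ^ 2 * T * Real.log T) ^ 8 := by positivity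
    norm_num at h2 h3 h4 h5 ⊢
    linarith

theorem one_add_div_le {σ C E T l : ℝ} (hσ : 0 ≤ σ) (hT : 0 < T) (hl : 1 / 2 ≤ l)
    (hC : 0 ≤ C) {X : ℝ} (hE : 0 ≤ E) (hX : X ≤ C * E * (1 + 2 * σ * √T)) :
    X / T ≤ 4 * C * E * (1 / T + σ * √l / √T) := by
  have h1 : 1 / 2 ≤ √l := Real.le_sqrt_of_sq_le (by norm_num; linarith)
  have h2 : 0 < √T := Real.sqrt_pos.2 hT
  have h3 : √T / T = 1 / √T := by
    rw [Real.sqrt_div_self', one_div]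
  calc X / T ≤ C * E * (1 + 2 * σ * √T) / T := by gcongr
    _ = C * E * (1 / T + 2 * σ * (√T / T)) := by ring
    _ = C * E * (1 / T + 2 * (σ / √T)) := by
      rw [h3]
      ring
    _ ≤ C * E * (4 * (1 / T + σ * √l / √T)) := by
      gcongr
      have h4 : σ / √T * (1 / 2) ≤ σ / √T * √l := by gcongr
      have h5 : σ / √T * √l = σ * √l / √T := by ring
      have h6 : 0 < 1 / T := by positivity
      linarith
    _ = _ := by ring

end AdaGradNorm

theorem mainTheorem2 :
    ∃ P : MvPolynomial (Fin 2) ℝ,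
      ∀ γ L η b₀ R : ℝ, 0 < γ → γ ≤ 1 → 0 < L → 0 < η → 0 < b₀ → 0 ≤ R →
      ∃ C : ℝ, 0 < C ∧
        ∀ (d : ℕ) (F : EuclideanSpace ℝ (Fin d) → ℝ) (xstar x₁ : EuclideanSpace ℝ (Fin d))
          (S : Type*) (_ : MeasurableSpace S) (Ω : Type*) (_ : MeasurableSpace Ω)
          (μ : Measure Ω) (_ : IsProbabilityMeasure μ)
          (g : EuclideanSpace ℝ (Fin d) → S → EuclideanSpace ℝ (Fin d)) (z : ℕ → Ω → S) (σ : ℝ),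
          Differentiable ℝ F →
          IsQuasarConvex γ F xstar →
          IsSmoothWith L F →
          ‖x₁ - xstar‖ ≤ R →
          0 ≤ σ →
          IsOracle μ g z →
          IsUnbiasedOracle μ F g z →
          HasSubGaussianNoise μ F g z σ →
          ∀ T : ℕ, 1 ≤ T →
            Integrable (fun ω => (∑ t ∈ Finset.Icc 1 T,
              (F (AdaGradNorm.iter g η b₀ x₁ (fun i => z i ω) t) - F xstar)) / (T : ℝ)) μ ∧
            ∫ ω, (∑ t ∈ Finset.Icc 1 T,
              (F (AdaGradNorm.iter g η b₀ x₁ (fun i => z i ω) t) - F xstar)) / (T : ℝ) ∂μ ≤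
              C * (1 + MvPolynomial.eval
                    ![σ ^ 2 * Real.log T, Real.log (1 + σ ^ 2 * T * Real.log T)] P) *
                (1 / (T : ℝ) + σ * Real.sqrt (Real.log T) / Real.sqrt T) := by
  -- The two eighth powers bound the moments of the maximal noise and of log(1 + Ξ) respectively.
  refine ⟨MvPolynomial.X 0 ^ 8 + MvPolynomial.X 1 ^ 8, ?_⟩
  intro γ L η b₀ R hγ _ hL hη hb hR
  obtain ⟨C, hC0, hC⟩ := AdaGradNorm.exists_integral_sum_gap_le (R := R) hγ hL hη hb
  -- The first summand serves T ≥ 2, the second T = 1, and the 1 makes the constant positive.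
  refine ⟨4 * (C * 2 ^ 34) + L / 2 * R ^ 2 + 1, by positivity, ?_⟩
  intro d F xstar x₁ S _ Ω _ μ _ g z σ hdiff hq hF hx hσ ho hu hn T hT
  have h := AdaGradNorm.stochPath_of_oracle hη hb hdiff hq hF hx hσ ho hu hn
  have hsum : ∀ ω, ∑ t ∈ Finset.Icc 1 T,
      (F (AdaGradNorm.iter g η b₀ x₁ (fun i => z i ω) t) - F xstar) =
      ∑ k ∈ Finset.range T,
        (F (AdaGradNorm.state g η b₀ x₁ (fun i => z i ω) k).1 - F xstar) := fun ω => by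
    rw [← Finset.Ico_add_one_right_eq_Icc, Finset.sum_Ico_eq_sum_range]
    simp only [add_tsub_cancel_right, AdaGradNorm.iter, add_tsub_cancel_left]
  simp only [hsum]
  refine ⟨(AdaGradNorm.HasMoments.sum h.δ_moments T).integrable.div_const _, ?_⟩
  rw [integral_div]
  simp only [map_add, map_pow, MvPolynomial.eval_X, Matrix.cons_val_zero, Matrix.cons_val_one]
  set E := 1 + ((σ ^ 2 * Real.log T) ^ 8 + Real.log (1 + σ ^ 2 * T * Real.log T) ^ 8) with hE
  have hE0 : 0 ≤ E := by positivity
  have hB0 : 0 ≤ 1 / (T : ℝ) + σ * √(Real.log T) / √T := by positivity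
  -- For T = 1 the logarithm vanishes and the right-hand side no longer sees σ. The average is then
  -- the deterministic gap at x₁, at most L R²/2 by smoothness.
  rcases hT.eq_or_lt with rfl | hT
  · have hΔ := AdaGradNorm.sub_min_le hF hq.2.2.1 x₁
    have hx2 := pow_le_pow_left₀ (norm_nonneg _) hx 2
    have hΔR : F x₁ - F xstar ≤ L / 2 * R ^ 2 := hΔ.trans (by gcongr)
    have hC' : 0 ≤ 4 * (C * 2 ^ 34) := by positivity
    simp only [Finset.range_one, Finset.sum_singleton, AdaGradNorm.state, integral_const,
      probReal_univ, one_smul, hE, Nat.cast_one, Real.log_one, Real.sqrt_zero, mul_zero,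
      add_zero, div_one, Real.sqrt_one, mul_one, ne_eq, OfNat.ofNat_ne_zero,
      not_false_eq_true, zero_pow]
    linarith
  · have hl := AdaGradNorm.half_le_log (show 2 ≤ T by omega)
    obtain ⟨h1, h2⟩ := AdaGradNorm.noiseAt_moment_bounds (η := η) (b₀ := b₀) (x₁ := x₁)
      hσ ho hn (show 2 ≤ T by omega)
    have h3 := hC μ _ _ _ _ _ _ _ h T (2 * σ * √T) (by positivity) h1
    have h4 : ∫ ω, ∑ k ∈ Finset.range T,
        (F (AdaGradNorm.state g η b₀ x₁ (fun i => z i ω) k).1 - F xstar) ∂μ ≤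
        C * 2 ^ 34 * E * (1 + 2 * σ * √T) := by
      refine h3.trans ?_
      rw [mul_assoc C (2 ^ 34) E]
      gcongr
    refine (AdaGradNorm.one_add_div_le hσ (by positivity) hl (by positivity) hE0 h4).trans ?_
    gcongr
    have : 0 ≤ L / 2 * R ^ 2 := by positivity
    linarith
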